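/- Let $d\ge 1$, let $\Omega\subset\mathbb{R}^d$ be a bounded open set, $\gamma\in\mathbb{R}$, $T>0$, $u_0\in H_0^1(\Omega)$, $f\in L_2(0,T;H_0^1(\Omega))$, and put $a(v)=\left(\int_\Omega v^2\,dx\right)^{\gamma}$. For $0<\tau\le T$, a weak solution on $\Omega\times(0,\tau)$ of the problem $$u_t-a(u)\Delta u=f \text{ in } \Omega\times(0,\tau),\qquad u=0\text{ on }\partial\Omega\times(0,\tau),\qquad u(x,0)=u_0(x)\text{ in }\Omega,$$ is a function $u\in L_2(0,\tau;H_0^1(\Omega))$ with weak time derivative $u_t\in L_2(0,\tau;L_2(\Omega))$ such that, for almost every $t\in(0,\tau)$, $$\int_\Omega u_t\,w\,dx+a(u(t))\int_\Omega\nabla u\cdot\nabla w\,dx=\int_\Omega f\,w\,dx\qquad\text{for all } w\in H_0^1(\Omega),$$ and $u(\cdot,0)=u_0$, where $u$ is identified with its representative in $C([0,\tau];L_2(\Omega))$. If $\gamma<0$ and $u(t)=0$, the product $a(u(t))\int_\Omega\nabla u\cdot\nabla w\,dx$ is understood to be $0$. Theorem. If $\int_\Omega u_0\,dx>0$, then there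 exists $t^*\in(0,T]$ such that, for every $\tau\in(0,t^*]$, the problem has exactly one weak solution on $\Omega\times(0,\tau)$. -/

import Mathlib

open MeasureTheory Set Topology
open scoped ContDiff Gradient

noncomputable section

/-- Euclidean space `ℝᵈ`. -/
abbrev Euc (d : ℕ) : Type := EuclideanSpace ℝ (Fin d)

/-- `L₂(Ω)`: real square-integrable functions on `Ω`, modulo a.e. equality. -/
abbrev L2 {d : ℕ} (Ω : Set (Euc d)) : Type :=
  Lp ℝ 2 ((volume : Measure (Euc d)).restrict Ω)

/-- `L₂(Ω; ℝᵈ)`: square-integrable vector fields on `Ω`, modulo a.e. equality. -/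
abbrev L2Vec {d : ℕ} (Ω : Set (Euc d)) : Type :=
  Lp (Euc d) 2 ((volume : Measure (Euc d)).restrict Ω)

/-- `φ ∈ C_c^∞(Ω)`: a smooth function whose support is a compact subset of `Ω`. -/
structure IsTestFunction {E : Type*} [NormedAddCommGroup E] [NormedSpace ℝ E]
    (Ω : Set E) (φ : E → ℝ) : Prop where
  smooth : ContDiff ℝ ∞ φ
  compact : HasCompactSupport φ
  support : tsupport φ ⊆ Ω

/-- The pairs `(φ, ∇φ) ∈ L₂(Ω) × L₂(Ω; ℝᵈ)` with `φ ∈ C_c^∞(Ω)`. The norm of the ambient Hilbert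
space, `(‖φ‖² + ‖∇φ‖²)^{1/2}`, is the norm of `H¹(Ω)`. -/
def testPairs {d : ℕ} (Ω : Set (Euc d)) :
    Submodule ℝ (WithLp 2 (L2 Ω × L2Vec Ω)) where
  carrier := {p | ∃ φ : Euc d → ℝ, IsTestFunction Ω φ ∧
    (p.fst : Euc d → ℝ) =ᵐ[volume.restrict Ω] φ ∧
    (p.snd : Euc d → Euc d) =ᵐ[volume.restrict Ω] (∇ φ)}
  zero_mem' := by
    refine ⟨fun _ => 0, ⟨contDiff_const, HasCompactSupport.zero, by simp [tsupport]⟩, ?_, ?_⟩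
    · exact Lp.coeFn_zero _ _ _
    · refine (Lp.coeFn_zero (Euc d) 2 (volume.restrict Ω)).trans (Filter.Eventually.of_forall ?_)
      intro x
      simp
  add_mem' := by
    rintro p q ⟨φ, hφ, hp1, hp2⟩ ⟨ψ, hψ, hq1, hq2⟩
    refine ⟨φ + ψ, ⟨hφ.smooth.add hψ.smooth, hφ.compact.add hψ.compact,
      (tsupport_add φ ψ).trans (union_subset hφ.support hψ.support)⟩, ?_, ?_⟩
    · exact (Lp.coeFn_add p.fst q.fst).trans (hp1.add hq1)
    · refine (Lp.coeFn_add p.snd q.snd).trans ((hp2.add hq2).trans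
        (Filter.Eventually.of_forall ?_))
      intro x
      have h1 := (hφ.smooth.differentiable (by simp) x)
      have h2 := (hψ.smooth.differentiable (by simp) x)
      simp [gradient, fderiv_add h1 h2]
  smul_mem' := by
    rintro c p ⟨φ, hφ, hp1, hp2⟩
    refine ⟨c • φ, ⟨hφ.smooth.const_smul c, hφ.compact.smul_left (f := fun _ => c),
      (tsupport_smul_subset_right (fun _ => c) φ).trans hφ.support⟩, ?_, ?_⟩
    · exact (Lp.coeFn_smul c p.fst).trans (hp1.const_smul c)
    · refine (Lp.coeFn_smul c p.snd).trans ((hp2.const_smul c).trans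
        (Filter.Eventually.of_forall ?_))
      intro x
      have h1 := (hφ.smooth.differentiable (by simp) x)
      simp [gradient, fderiv_const_smul h1 c]

/-- `H₀¹(Ω)`: the closure of `C_c^∞(Ω)` in the norm of `H¹(Ω)`. An element is stored together with
its weak gradient (see `hasWeakGradient_grad`), so that the norm is the `H¹` norm. -/
def H01 {d : ℕ} (Ω : Set (Euc d)) : Submodule ℝ (WithLp 2 (L2 Ω × L2Vec Ω)) :=
  (testPairs Ω).topologicalClosure

/-- The element of `L₂(Ω)` underlying an element of `H₀¹(Ω)`. -/
def toL2 {d : ℕ} {Ω : Set (Euc d)} (v : H01 Ω) : L2 Ω :=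
  (v : WithLp 2 (L2 Ω × L2Vec Ω)).fst

/-- The gradient of an element of `H₀¹(Ω)`. -/
def grad {d : ℕ} {Ω : Set (Euc d)} (v : H01 Ω) : L2Vec Ω :=
  (v : WithLp 2 (L2 Ω × L2Vec Ω)).snd

/-- `g` is the weak gradient of `v` on `Ω`: `∫_Ω v ∂ᵢφ = -∫_Ω gᵢ φ` for all `φ ∈ C_c^∞(Ω)`. -/
def HasWeakGradient {d : ℕ} (Ω : Set (Euc d)) (v : L2 Ω) (g : L2Vec Ω) : Prop :=
  ∀ φ : Euc d → ℝ, IsTestFunction Ω φ → ∀ i : Fin d,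
    ∫ x in Ω, v x * (∇ φ x) i = -∫ x in Ω, g x i * φ x

theorem IsTestFunction.gradient_continuous {d : ℕ} {Ω : Set (Euc d)} {φ : Euc d → ℝ}
    (hφ : IsTestFunction Ω φ) : Continuous (∇ φ) := by
  have h := hφ.smooth.continuous_fderiv (by simp)
  exact (InnerProductSpace.toDual ℝ (Euc d)).symm.continuous.comp h

theorem IsTestFunction.gradient_compact {d : ℕ} {Ω : Set (Euc d)} {φ : Euc d → ℝ}
    (hφ : IsTestFunction Ω φ) : HasCompactSupport (∇ φ) :=
  (hφ.compact.fderiv (𝕜 := ℝ)).comp_left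
    (g := (InnerProductSpace.toDual ℝ (Euc d)).symm) (by simp)

theorem gradient_coord {d : ℕ} (φ : Euc d → ℝ) (x : Euc d) (i : Fin d) :
    (∇ φ x) i = fderiv ℝ φ x (EuclideanSpace.single i 1) := by
  have h : inner ℝ (∇ φ x) (EuclideanSpace.single i (1 : ℝ))
      = fderiv ℝ φ x (EuclideanSpace.single i 1) := by
    rw [gradient, InnerProductSpace.toDual_symm_apply]
  rw [← h, EuclideanSpace.inner_single_right]
  simp

/-- The second component of an element of `H₀¹(Ω)` is the weak gradient of the first one. -/
theorem hasWeakGradient_grad {d : ℕ} {Ω : Set (Euc d)} (v : H01 Ω) :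
    HasWeakGradient Ω (toL2 v) (grad v) := by
  intro φ hφ i
  have hc : Continuous fun x => (∇ φ x) i :=
    (EuclideanSpace.proj (𝕜 := ℝ) i).continuous.comp hφ.gradient_continuous
  have hs : HasCompactSupport fun x => (∇ φ x) i :=
    hφ.gradient_compact.comp_left (g := fun y : Euc d => y i) rfl
  have hm1 : MemLp (fun x => (∇ φ x) i) 2 (volume.restrict Ω) :=
    hc.memLp_of_hasCompactSupport hs
  have hm2 : MemLp (fun x => φ x • EuclideanSpace.single i (1 : ℝ)) 2 (volume.restrict Ω) :=
    (hφ.smooth.continuous.smul continuous_const).memLp_of_hasCompactSupport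
      (hφ.compact.smul_right (f' := fun _ => EuclideanSpace.single i (1 : ℝ)))
  have key : ∀ p : WithLp 2 (L2 Ω × L2Vec Ω),
      (∫ x in Ω, p.fst x * (∇ φ x) i) + ∫ x in Ω, p.snd x i * φ x
        = inner ℝ p.fst (hm1.toLp _) + inner ℝ p.snd (hm2.toLp _) := by
    intro p
    rw [L2.inner_def, L2.inner_def]
    congr 1
    · refine integral_congr_ae ?_
      filter_upwards [hm1.coeFn_toLp] with x hx
      rw [hx]
      simp [mul_comm]
    · refine integral_congr_ae ?_
      filter_upwards [hm2.coeFn_toLp] with x hx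
      rw [hx, inner_smul_right, EuclideanSpace.inner_single_right]
      simp [mul_comm]
  have hcl : IsClosed {p : WithLp 2 (L2 Ω × L2Vec Ω) |
      inner ℝ p.fst (hm1.toLp _) + inner ℝ p.snd (hm2.toLp _) = (0 : ℝ)} := by
    refine isClosed_eq ?_ continuous_const
    exact ((WithLp.prod_continuous_ofLp 2 _ _).fst.inner continuous_const).add
      ((WithLp.prod_continuous_ofLp 2 _ _).snd.inner continuous_const)
  have hsub : (testPairs Ω : Set (WithLp 2 (L2 Ω × L2Vec Ω))) ⊆ {p |
      inner ℝ p.fst (hm1.toLp _) + inner ℝ p.snd (hm2.toLp _) = (0 : ℝ)} := by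
    rintro p ⟨ψ, hψ, h1, h2⟩
    rw [mem_ofPred_eq, ← key p]
    have hψc : Continuous fun x => (∇ ψ x) i :=
      (EuclideanSpace.proj (𝕜 := ℝ) i).continuous.comp hψ.gradient_continuous
    have e1 : ∫ x in Ω, p.fst x * (∇ φ x) i = ∫ x, ψ x * (∇ φ x) i := by
      rw [← setIntegral_eq_integral_of_forall_compl_eq_zero (s := Ω)
        (f := fun x => ψ x * (∇ φ x) i)]
      · refine integral_congr_ae ?_
        filter_upwards [h1] with x hx
        rw [hx]
      · intro x hx
        rw [image_eq_zero_of_notMem_tsupport (fun h => hx (hψ.support h)), zero_mul]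
    have e2 : ∫ x in Ω, p.snd x i * φ x = ∫ x, (∇ ψ x) i * φ x := by
      rw [← setIntegral_eq_integral_of_forall_compl_eq_zero (s := Ω)
        (f := fun x => (∇ ψ x) i * φ x)]
      · refine integral_congr_ae ?_
        filter_upwards [h2] with x hx
        rw [hx]
      · intro x hx
        rw [image_eq_zero_of_notMem_tsupport (fun h => hx (hφ.support h)), mul_zero]
    rw [e1, e2]
    have i1 : Integrable fun x => (∇ ψ x) i * φ x :=
      (hψc.mul hφ.smooth.continuous).integrable_of_hasCompactSupport hφ.compact.mul_left
    have i2 : Integrable fun x => ψ x * (∇ φ x) i :=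
      (hψ.smooth.continuous.mul hc).integrable_of_hasCompactSupport hψ.compact.mul_right
    have i3 : Integrable fun x => ψ x * φ x :=
      (hψ.smooth.continuous.mul hφ.smooth.continuous).integrable_of_hasCompactSupport
        hψ.compact.mul_right
    simp only [gradient_coord] at i1 i2 ⊢
    rw [integral_mul_fderiv_eq_neg_fderiv_mul_of_integrable i1 i2 i3
      (fun x _ => hψ.smooth.differentiable (by simp) x)
      (fun x _ => hφ.smooth.differentiable (by simp) x)]
    simp
  have hmem := (closure_minimal hsub hcl) (show (v : WithLp 2 (L2 Ω × L2Vec Ω)) ∈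
    closure (testPairs Ω : Set (WithLp 2 (L2 Ω × L2Vec Ω))) from v.2)
  rw [mem_ofPred_eq, ← key] at hmem
  exact eq_neg_of_add_eq_zero_left hmem

/-- `u'` is the weak derivative of `u` on `(0,T)`:
`∫₀ᵀ φ' u dt = -∫₀ᵀ φ u' dt` in `L₂(Ω)`, for all `φ ∈ C_c^∞(0,T)`. -/
def HasWeakTimeDeriv {d : ℕ} {Ω : Set (Euc d)} (T : ℝ) (u u' : ℝ → L2 Ω) : Prop :=
  ∀ φ : ℝ → ℝ, IsTestFunction (Ioo 0 T) φ →
    ∫ t in Ioo 0 T, deriv φ t • u t = -∫ t in Ioo 0 T, φ t • u' t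

/-- `L₂(0,T; X)`, modulo equality for almost every `t`. -/
abbrev L2Time (T : ℝ) (X : Type) [NormedAddCommGroup X] : Type :=
  Lp X 2 ((volume : Measure ℝ).restrict (Ioo 0 T))

/-- The nonlocal diffusion coefficient `a(v) = (∫_Ω v² dx)^γ`. For `γ < 0` and `v = 0` the value
is the conventional `0`; there `a(v)` only multiplies `∇v = 0`. -/
def diffusionCoeff {d : ℕ} {Ω : Set (Euc d)} (γ : ℝ) (v : L2 Ω) : ℝ :=
  (∫ x in Ω, (v x) ^ 2) ^ γ

/-- `u` is a weak solution on `Ω × (0,T)` of `u_t - a(u) Δu = f`, `u = 0` on `∂Ω`, `u(·,0) = u₀`.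
The boundary condition is that `u(t) ∈ H₀¹(Ω)`. The initial condition refers to the representative
of `u` in `C([0,T]; L₂(Ω))`. -/
def IsWeakSolution {d : ℕ} (Ω : Set (Euc d)) (γ T : ℝ) (u₀ : H01 Ω) (f : ℝ → H01 Ω)
    (u : L2Time T (H01 Ω)) : Prop :=
  (∃ ut : L2Time T (L2 Ω),
    HasWeakTimeDeriv T (fun t => toL2 (u t)) ut ∧
    ∀ᵐ t ∂(volume.restrict (Ioo 0 T)), ∀ w : H01 Ω,
      (∫ x in Ω, ut t x * toL2 w x)
        + diffusionCoeff γ (toL2 (u t)) * (∫ x in Ω, inner ℝ (grad (u t) x) (grad w x))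
        = ∫ x in Ω, toL2 (f t) x * toL2 w x) ∧
  ∃ U : ℝ → L2 Ω, ContinuousOn U (Icc 0 T) ∧
    (∀ᵐ t ∂(volume.restrict (Ioo 0 T)), U t = toL2 (u t)) ∧ U 0 = toL2 u₀

end

/-! ### Absolutely continuous functions with values in a Banach space -/

section AbsolutelyContinuous


/-! A positive integral forces u₀ ≠ 0 in L₂(Ω), and nothing more is taken from that assumption. On
the ball of radius ‖u₀‖/2 about u₀ the coefficient (‖v‖²)^γ is Lipschitz and lies between positive
constants, whatever the sign of γ. `exists_lipschitz_cutoff` extends it from this ball to all of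
L₂(Ω) with the same properties, so the degeneracy at v = 0 disappears.

For a prescribed continuous coefficient with 0 < α ≤ a(t) ≤ β the linear problem is solved by
`exists_isEvolution`. Formally one divides by a and tests with u_t: the coefficient then sits on u_t
rather than on the elliptic term, so no derivative of a is needed. Lions' projection lemma makes
this rigorous, with u_t and ∇(u - u₀) as the unknowns. The result is ‖u_t‖ ≤ D, where D can be
chosen independently of τ, and ‖∇u‖ ≤ √τ (D + ‖∇u₀‖) in L₂(0,τ).

By `IsEvolution.energy_sub_le`, two solutions with coefficients a₁, a₂ differ by at most a multiple
of sup |a₁ - a₂| · ‖∇u₂‖, and the last factor is O(√τ). Evaluating the coefficient along a given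
curve and solving is therefore a contraction of C([0,τ]; L₂(Ω)) for small τ. The fixed point
satisfies ‖u(t) - u₀‖ ≤ √τ D, so it stays in the ball where the cutoff is inactive and solves the
original problem.

For uniqueness, an arbitrary second solution agrees with the constructed one as long as it stays in
the ball. At a first exit time it would equal a point strictly inside, which is absurd. The estimate
involves only the gradient of the constructed solution, so no a priori bound on the other one is
needed. -/

theorem AbsolutelyContinuousOnInterval.of_dist_le {X Y : Type*} [PseudoMetricSpace X]
    [PseudoMetricSpace Y] {F : ℝ → X} {K : ℝ → Y} {a b C : ℝ}
    (hK : AbsolutelyContinuousOnInterval K a b) (hC : 0 ≤ C)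
    (h : ∀ x ∈ uIcc a b, ∀ y ∈ uIcc a b, dist (F x) (F y) ≤ C * dist (K x) (K y)) :
    AbsolutelyContinuousOnInterval F a b := by
  rw [absolutelyContinuousOnInterval_iff] at hK ⊢
  intro ε hε
  obtain ⟨δ, hδ, H⟩ := hK (ε / (C + 1)) (by positivity)
  refine ⟨δ, hδ, fun E hE hlt => ?_⟩
  have h1 := H E hE hlt
  calc ∑ i ∈ Finset.range E.1, dist (F (E.2 i).1) (F (E.2 i).2)
      ≤ ∑ i ∈ Finset.range E.1, C * dist (K (E.2 i).1) (K (E.2 i).2) :=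
        Finset.sum_le_sum fun i hi => h _ (hE.1 i hi).1 _ (hE.1 i hi).2
    _ = C * ∑ i ∈ Finset.range E.1, dist (K (E.2 i).1) (K (E.2 i).2) := by
        rw [Finset.mul_sum]
    _ ≤ C * (ε / (C + 1)) := by gcongr
    _ < (C + 1) * (ε / (C + 1)) := by gcongr; linarith
    _ = ε := by field

variable {X : Type*} [NormedAddCommGroup X] [NormedSpace ℝ X]

theorem absolutelyContinuousOnInterval_primitive {g : ℝ → X} {a b : ℝ} (x₀ : X)
    (hg : IntervalIntegrable g volume a b) :
    AbsolutelyContinuousOnInterval (fun t => x₀ + ∫ s in a..t, g s) a b := by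
  refine (hg.norm.absolutelyContinuousOnInterval_intervalIntegral
    (left_mem_uIcc)).of_dist_le zero_le_one fun x hx y hy => ?_
  have hax : IntervalIntegrable g volume a x := hg.mono_set (uIcc_subset_uIcc_left hx)
  have hay : IntervalIntegrable g volume a y := hg.mono_set (uIcc_subset_uIcc_left hy)
  rw [dist_eq_norm, dist_eq_norm, add_sub_add_left_eq_sub,
    intervalIntegral.integral_interval_sub_left hax hay,
    intervalIntegral.integral_interval_sub_left hax.norm hay.norm, one_mul]
  exact intervalIntegral.norm_integral_le_abs_integral_norm

/-- Absolute continuity does not give a.e. differentiability in a general Banach space, so the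
derivative is part of the data. Subtracting the primitive of `F'` leaves an absolutely continuous
function with zero derivative a.e., hence a constant. -/
theorem AbsolutelyContinuousOnInterval.integral_eq_sub_of_ae_hasDerivAt {F F' : ℝ → X} {a b : ℝ}
    (hF : AbsolutelyContinuousOnInterval F a b)
    (hd : ∀ᵐ x, x ∈ uIcc a b → HasDerivAt F (F' x) x)
    (hi : IntervalIntegrable F' volume a b) [CompleteSpace X] :
    ∫ x in a..b, F' x = F b - F a := by
  have hac := hF.sub (absolutelyContinuousOnInterval_primitive 0 hi)
  obtain ⟨C, hC⟩ := hac.const_of_ae_hasDerivAt_zero (by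
    filter_upwards [hd, hi.ae_hasDerivAt_integral] with x h1 h2 hx
    have := (h1 hx).sub ((h2 hx a left_mem_uIcc).const_add 0)
    rwa [sub_self] at this)
  have ha := hC a left_mem_uIcc
  have hb := hC b right_mem_uIcc
  simp only [Pi.sub_apply, intervalIntegral.integral_same, zero_add, sub_zero] at ha hb
  rw [ha, ← hb]
  abel

theorem integral_smul_primitive [CompleteSpace X] {g : ℝ → X} {a b : ℝ} (x₀ : X)
    (hg : IntervalIntegrable g volume a b) {φ : ℝ → ℝ} (hφ : ContDiff ℝ 1 φ) :
    (∫ t in a..b, (φ t • g t + deriv φ t • (x₀ + ∫ s in a..t, g s)))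
      = φ b • (x₀ + ∫ s in a..b, g s) - φ a • x₀ := by
  have hV := absolutelyContinuousOnInterval_primitive x₀ hg
  have hφ' := (hφ.contDiffOn (s := uIcc a b)).absolutelyContinuousOnInterval
  rw [(hφ'.fun_smul hV).integral_eq_sub_of_ae_hasDerivAt]
  · simp
  · filter_upwards [hg.ae_hasDerivAt_integral] with x hx hxm
    exact ((hφ.differentiable one_ne_zero x).hasDerivAt).smul
      ((hx hxm a left_mem_uIcc).const_add x₀)
  · exact (hg.continuousOn_smul hφ.continuous.continuousOn).add
      (((hφ.continuous_deriv le_rfl).continuousOn.smul hV.continuousOn).intervalIntegrable)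

variable {Z : Type*} [NormedAddCommGroup Z] [InnerProductSpace ℝ Z]

/-- Source of the energy identities below: the product rule for φ‖V‖², where V is the primitive of
`g`. The function ‖V‖² is absolutely continuous because V is, and V is bounded. -/
theorem integral_energy_primitive [CompleteSpace Z] {g : ℝ → Z} {a b : ℝ} (x₀ : Z)
    (hg : IntervalIntegrable g volume a b) {φ : ℝ → ℝ} (hφ : ContDiff ℝ 1 φ) :
    (∫ t in a..b, (φ t * (2 * inner ℝ (x₀ + ∫ s in a..t, g s) (g t))
        + deriv φ t * ‖x₀ + ∫ s in a..t, g s‖ ^ 2))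
      = φ b * ‖x₀ + ∫ s in a..b, g s‖ ^ 2 - φ a * ‖x₀‖ ^ 2 := by
  have hV := absolutelyContinuousOnInterval_primitive x₀ hg
  have hφ' := (hφ.contDiffOn (s := uIcc a b)).absolutelyContinuousOnInterval
  obtain ⟨C, hC⟩ := hV.exists_bound
  have hC0 : 0 ≤ C := (norm_nonneg _).trans (hC a left_mem_uIcc)
  have hN : AbsolutelyContinuousOnInterval (fun t => ‖x₀ + ∫ s in a..t, g s‖ ^ 2) a b := by
    refine hV.of_dist_le (C := 2 * C) (by positivity) fun x hx y hy => ?_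
    have h1 := hC x hx
    have h2 := hC y hy
    rw [dist_eq_norm, dist_eq_norm, Real.norm_eq_abs, sq_sub_sq, abs_mul]
    refine mul_le_mul ?_ (abs_norm_sub_norm_le _ _) (abs_nonneg _) (by positivity)
    rw [abs_of_nonneg (by positivity)]
    linarith
  rw [(hφ'.fun_mul hN).integral_eq_sub_of_ae_hasDerivAt]
  · simp
  · filter_upwards [hg.ae_hasDerivAt_integral] with x hx hxm
    have := ((hφ.differentiable one_ne_zero x).hasDerivAt).mul
      ((hx hxm a left_mem_uIcc).const_add x₀).norm_sq
    rwa [add_comm] at this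
  · refine IntervalIntegrable.add ?_ ?_
    · have h3 : IntervalIntegrable (fun t => inner ℝ (x₀ + ∫ s in a..t, g s) (g t)) volume a b := by
        rw [intervalIntegrable_iff] at hg ⊢
        refine (hg.norm.const_mul C).mono' ?_ ?_
        · exact ((hV.continuousOn.mono uIoc_subset_uIcc).aestronglyMeasurable
            measurableSet_uIoc).inner hg.aestronglyMeasurable
        · filter_upwards [ae_restrict_mem measurableSet_uIoc] with t ht
          exact (norm_inner_le_norm _ _).trans
            (mul_le_mul_of_nonneg_right (hC t (uIoc_subset_uIcc ht)) (norm_nonneg _))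
      exact (h3.const_mul 2).continuousOn_mul hφ.continuous.continuousOn
    · exact ((hφ.continuous_deriv le_rfl).continuousOn.mul hN.continuousOn).intervalIntegrable

end AbsolutelyContinuous

/-! ### Weak time derivatives and primitives -/

section WeakTimeDerivative

variable {X : Type*} [NormedAddCommGroup X] [NormedSpace ℝ X]

/-- The mean-zero condition makes the primitive vanish to the right of the support of `h` as well as
to the left, so its support lies in the convex hull of that of `h`. -/
theorem IsTestFunction.primitive {τ : ℝ} {h : ℝ → ℝ}
    (hh : IsTestFunction (Ioo 0 τ) h) (h0 : ∫ t in (0 : ℝ)..τ, h t = 0) :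
    IsTestFunction (Ioo 0 τ) (fun t => ∫ s in (0 : ℝ)..t, h s) := by
  have hd : ∀ t, HasDerivAt (fun t => ∫ s in (0 : ℝ)..t, h s) (h t) t := fun t =>
    hh.smooth.continuous.integral_hasStrictDerivAt 0 t |>.hasDerivAt
  have hsm : ContDiff ℝ ∞ (fun t => ∫ s in (0 : ℝ)..t, h s) := by
    rw [contDiff_infty_iff_deriv]
    refine ⟨fun t => (hd t).differentiableAt, ?_⟩
    rw [funext fun t => (hd t).deriv]
    exact hh.smooth
  by_cases hne : (tsupport h).Nonempty
  · obtain ⟨a, ha, hal⟩ := hh.compact.isCompact.exists_isLeast hne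
    obtain ⟨b, hb, hbg⟩ := hh.compact.isCompact.exists_isGreatest hne
    have ha' := hh.support ha
    have hb' := hh.support hb
    have hz : ∀ t, t ∉ Icc a b → h t = 0 := fun t ht =>
      image_eq_zero_of_notMem_tsupport fun hm => ht ⟨hal hm, hbg hm⟩
    have hint : ∀ x y, IntervalIntegrable h volume x y := fun x y =>
      hh.smooth.continuous.intervalIntegrable x y
    have hsupp : Function.support (fun t => ∫ s in (0 : ℝ)..t, h s) ⊆ Icc a b := by
      intro t ht
      by_contra hcon
      apply ht
      rw [mem_Icc, not_and_or, not_le, not_le] at hcon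
      rcases hcon with hta | htb
      · refine intervalIntegral.integral_zero_ae (.of_forall fun s hs => hz s fun hs' => ?_)
        have : s ≤ max 0 t := hs.2
        have h2 : max 0 t < a := max_lt ha'.1 hta
        linarith [hs'.1]
      · change ∫ s in (0 : ℝ)..t, h s = 0
        rw [← intervalIntegral.integral_add_adjacent_intervals (hint 0 τ) (hint τ t), h0, zero_add]
        refine intervalIntegral.integral_zero_ae (.of_forall fun s hs => hz s fun hs' => ?_)
        have : min τ t < s := hs.1
        have h2 : b < min τ t := lt_min hb'.2 htb
        linarith [hs'.2]
    have hts : tsupport (fun t => ∫ s in (0 : ℝ)..t, h s) ⊆ Icc a b :=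
      closure_minimal hsupp isClosed_Icc
    exact ⟨hsm, HasCompactSupport.of_support_subset_isCompact isCompact_Icc hsupp,
      hts.trans fun x hx => ⟨ha'.1.trans_le hx.1, hx.2.trans_lt hb'.2⟩⟩
  · have : h = 0 := by
      rw [not_nonempty_iff_eq_empty] at hne
      exact tsupport_eq_empty_iff.mp hne
    subst this
    simp only [Pi.zero_apply, intervalIntegral.integral_zero]
    exact ⟨contDiff_const, HasCompactSupport.zero, by simp [tsupport]⟩

theorem exists_isTestFunction_integral_eq_one {τ : ℝ} (hτ : 0 < τ) :
    ∃ φ : ℝ → ℝ, IsTestFunction (Ioo 0 τ) φ ∧ ∫ t in (0 : ℝ)..τ, φ t = 1 := by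
  let b : ContDiffBump (τ / 2) := ⟨τ / 8, τ / 4, by positivity, by linarith⟩
  have hs : tsupport (b.normed volume) ⊆ Ioo 0 τ := by
    rw [b.tsupport_normed_eq, Real.closedBall_eq_Icc]
    intro x hx
    have h1 : τ / 2 - τ / 4 ≤ x := hx.1
    have h2 : x ≤ τ / 2 + τ / 4 := hx.2
    constructor <;> linarith
  refine ⟨b.normed volume, ⟨b.contDiff_normed, b.hasCompactSupport_normed, hs⟩, ?_⟩
  rw [intervalIntegral.integral_of_le hτ.le, setIntegral_eq_integral_of_forall_compl_eq_zero,
    b.integral_normed]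
  intro x hx
  exact image_eq_zero_of_notMem_tsupport fun h => hx (Ioo_subset_Ioc_self (hs h))

/-- Du Bois-Reymond's argument. Subtracting from φ its integral times a fixed bump φ₀ of integral
one leaves the derivative of a test function. Hence D - ∫ φ₀ D annihilates every φ and vanishes
a.e., and by continuity everywhere. -/
theorem eqOn_const_of_integral_deriv_smul_eq_zero [CompleteSpace X] {τ : ℝ} (hτ : 0 < τ)
    {D : ℝ → X} (hD : ContinuousOn D (Icc 0 τ))
    (h : ∀ φ : ℝ → ℝ, IsTestFunction (Ioo 0 τ) φ → ∫ t in (0 : ℝ)..τ, deriv φ t • D t = 0) :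
    ∀ t ∈ Icc 0 τ, D t = D 0 := by
  obtain ⟨φ₀, hφ₀, h1⟩ := exists_isTestFunction_integral_eq_one hτ
  set C := ∫ t in (0 : ℝ)..τ, φ₀ t • D t with hC
  have hDu : ContinuousOn D (uIcc 0 τ) := by rwa [uIcc_of_le hτ.le]
  have hint : ∀ {φ : ℝ → ℝ}, Continuous φ →
      IntervalIntegrable (fun t => φ t • D t) volume 0 τ := fun hφ =>
    (hφ.continuousOn.smul hDu).intervalIntegrable
  have key : ∀ φ : ℝ → ℝ, IsTestFunction (Ioo 0 τ) φ →
      ∫ t in (0 : ℝ)..τ, φ t • (D t - C) = 0 := by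
    intro φ hφ
    set c := ∫ t in (0 : ℝ)..τ, φ t with hc
    have hψ : IsTestFunction (Ioo 0 τ) (fun t => φ t - c * φ₀ t) :=
      ⟨hφ.smooth.sub (contDiff_const.mul hφ₀.smooth),
        hφ.compact.sub (hφ₀.compact.mul_left),
        (tsupport_sub _ _).trans (union_subset hφ.support
          ((tsupport_mul_subset_right).trans hφ₀.support))⟩
    have hψ0 : ∫ t in (0 : ℝ)..τ, (φ t - c * φ₀ t) = 0 := by
      rw [intervalIntegral.integral_sub (hφ.smooth.continuous.intervalIntegrable _ _)
        ((hφ₀.smooth.continuous.intervalIntegrable _ _).const_mul c),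
        intervalIntegral.integral_const_mul, h1, mul_one, sub_self]
    have h2 := h _ (hψ.primitive hψ0)
    have h3 : ∀ t, deriv (fun t => ∫ s in (0 : ℝ)..t, (φ s - c * φ₀ s)) t = φ t - c * φ₀ t :=
      fun t => (hψ.smooth.continuous.integral_hasStrictDerivAt 0 t).hasDerivAt.deriv
    simp only [h3, sub_smul, mul_smul] at h2
    have hi : IntervalIntegrable (fun t => c • φ₀ t • D t) volume 0 τ :=
      (hint hφ₀.smooth.continuous).smul c
    rw [intervalIntegral.integral_sub (hint hφ.smooth.continuous) hi,
      intervalIntegral.integral_smul, ← hC] at h2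
    simp only [smul_sub]
    have hi' : IntervalIntegrable (fun t => φ t • C) volume 0 τ :=
      (hφ.smooth.continuous.smul continuous_const).intervalIntegrable _ _
    rw [intervalIntegral.integral_sub (hint hφ.smooth.continuous) hi',
      intervalIntegral.integral_smul_const, ← hc, h2]
  have hae := isOpen_Ioo.ae_eq_zero_of_integral_contDiff_smul_eq_zero (U := Ioo 0 τ)
    (f := fun t => D t - C) (μ := volume)
    (((hD.sub continuousOn_const).mono Ioo_subset_Icc_self).locallyIntegrableOn
      measurableSet_Ioo) (by
      intro φ h1 h2 h3
      rw [← key φ ⟨h1, h2, h3⟩, intervalIntegral.integral_of_le hτ.le,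
        setIntegral_eq_integral_of_forall_compl_eq_zero]
      intro x hx
      rw [image_eq_zero_of_notMem_tsupport fun h => hx (Ioo_subset_Ioc_self (h3 h)), zero_smul])
  have heq : EqOn D (fun _ => C) (Icc 0 τ) := by
    refine Measure.eqOn_Icc_of_ae_eq (μ := volume) hτ.ne ?_ hD continuousOn_const
    rw [← restrict_Ioo_eq_restrict_Icc]
    filter_upwards [ae_restrict_of_ae hae, ae_restrict_mem measurableSet_Ioo] with t ht htm
    exact sub_eq_zero.mp (ht htm)
  intro t ht
  rw [heq ht, heq ⟨le_rfl, hτ.le⟩]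

theorem eqOn_primitive_of_weak_deriv [CompleteSpace X] {τ : ℝ} (hτ : 0 < τ)
    {U g : ℝ → X} (hU : ContinuousOn U (Icc 0 τ)) (hg : IntervalIntegrable g volume 0 τ)
    (h : ∀ φ : ℝ → ℝ, IsTestFunction (Ioo 0 τ) φ →
      ∫ t in (0 : ℝ)..τ, deriv φ t • U t = -∫ t in (0 : ℝ)..τ, φ t • g t) :
    ∀ t ∈ Icc 0 τ, U t = U 0 + ∫ s in (0 : ℝ)..t, g s := by
  have hI : ContinuousOn (fun t => ∫ s in (0 : ℝ)..t, g s) (Icc 0 τ) := by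
    have := (absolutelyContinuousOnInterval_primitive 0 hg).continuousOn
    simpa only [zero_add, uIcc_of_le hτ.le] using this
  have h1 := eqOn_const_of_integral_deriv_smul_eq_zero hτ (hU.sub hI) (by
    intro φ hφ
    have hφ' : Continuous (deriv φ) := hφ.smooth.continuous_deriv (by simp)
    have h2 := integral_smul_primitive 0 hg (hφ.smooth.of_le (by simp) : ContDiff ℝ 1 φ)
    have e0 : φ 0 = 0 := image_eq_zero_of_notMem_tsupport fun h => (hφ.support h).1.false
    have e1 : φ τ = 0 := image_eq_zero_of_notMem_tsupport fun h => (hφ.support h).2.false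
    simp only [zero_add, e0, e1, zero_smul, sub_zero] at h2
    have i1 : IntervalIntegrable (fun t => deriv φ t • U t) volume 0 τ := by
      refine (hφ'.continuousOn.smul ?_).intervalIntegrable
      rwa [uIcc_of_le hτ.le]
    have i2 : IntervalIntegrable (fun t => deriv φ t • ∫ s in (0 : ℝ)..t, g s) volume 0 τ := by
      refine (hφ'.continuousOn.smul ?_).intervalIntegrable
      rwa [uIcc_of_le hτ.le]
    have i3 : IntervalIntegrable (fun t => φ t • g t) volume 0 τ :=
      hg.continuousOn_smul hφ.smooth.continuous.continuousOn
    rw [intervalIntegral.integral_add i3 i2] at h2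
    simp only [Pi.sub_apply, smul_sub]
    rw [intervalIntegral.integral_sub i1 i2, h φ hφ, ← neg_add', h2, neg_zero])
  intro t ht
  have h2 := h1 t ht
  simp only [Pi.sub_apply, intervalIntegral.integral_same, sub_zero] at h2
  rw [← h2]
  abel

theorem weak_deriv_primitive [CompleteSpace X] {τ : ℝ} (x₀ : X)
    {g : ℝ → X} (hg : IntervalIntegrable g volume 0 τ) {φ : ℝ → ℝ}
    (hφ : IsTestFunction (Ioo 0 τ) φ) :
    ∫ t in (0 : ℝ)..τ, deriv φ t • (x₀ + ∫ s in (0 : ℝ)..t, g s)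
      = -∫ t in (0 : ℝ)..τ, φ t • g t := by
  have h2 := integral_smul_primitive x₀ hg (hφ.smooth.of_le (by simp) : ContDiff ℝ 1 φ)
  have e0 : φ 0 = 0 := image_eq_zero_of_notMem_tsupport fun h => (hφ.support h).1.false
  have e1 : φ τ = 0 := image_eq_zero_of_notMem_tsupport fun h => (hφ.support h).2.false
  rw [e0, e1, zero_smul, zero_smul, sub_zero, intervalIntegral.integral_add] at h2
  · exact eq_neg_of_add_eq_zero_right h2
  · exact hg.continuousOn_smul hφ.smooth.continuous.continuousOn
  · exact ((hφ.smooth.continuous_deriv (by simp)).continuousOn.smul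
      (absolutelyContinuousOnInterval_primitive x₀ hg).continuousOn).intervalIntegrable

end WeakTimeDerivative

/-! ### Lions' projection lemma -/

section Lions

/-- Lions' projection lemma. -/
theorem exists_mem_closure_range_of_coercive {E P : Type*} [AddCommGroup E] [Module ℝ E]
    [NormedAddCommGroup P] [InnerProductSpace ℝ P] [CompleteSpace P]
    (J K : E →ₗ[ℝ] P) (L : E →ₗ[ℝ] ℝ) {c C : ℝ} (hc : 0 < c) (hC : 0 ≤ C)
    (hJ : ∀ ψ, c * ‖J ψ‖ ^ 2 ≤ inner ℝ (K ψ) (J ψ)) (hL : ∀ ψ, |L ψ| ≤ C * ‖J ψ‖) :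
    ∃ u ∈ closure (range J), ‖u‖ ≤ C / c ∧ ∀ ψ, inner ℝ (K ψ) u = L ψ := by
  let M : Submodule ℝ P := (LinearMap.range J).topologicalClosure
  have hM : IsClosed (M : Set P) := Submodule.isClosed_topologicalClosure _
  have : CompleteSpace M := hM.completeSpace_coe
  have hJM : ∀ ψ, J ψ ∈ M := fun ψ => subset_closure ⟨ψ, rfl⟩
  -- Projecting `K` onto the closure of the range of `J` loses nothing in the pairing with `J ψ`,
  -- and it lets the solution be sought inside that closure.
  let S : E →ₗ[ℝ] M := M.orthogonalProjectionOnto.toLinearMap ∘ₗ K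
  have hS : ∀ ψ (m : M), inner ℝ (S ψ) m = inner ℝ (K ψ) (m : P) := fun ψ m =>
    Submodule.inner_orthogonalProjectionOnto_eq_of_mem_right m (K ψ)
  have hbd : ∀ ψ, c * ‖J ψ‖ ≤ ‖S ψ‖ := by
    intro ψ
    rcases eq_or_ne (J ψ) 0 with h0 | h0
    · simp [h0]
    · have h1 := hJ ψ
      rw [show inner ℝ (K ψ) (J ψ) = inner ℝ (S ψ) (⟨J ψ, hJM ψ⟩ : M) from (hS ψ ⟨_, hJM ψ⟩).symm]
        at h1
      have h2 := real_inner_le_norm (S ψ) (⟨J ψ, hJM ψ⟩ : M)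
      have h3 : 0 < ‖J ψ‖ := norm_pos_iff.mpr h0
      have h4 : ‖(⟨J ψ, hJM ψ⟩ : M)‖ = ‖J ψ‖ := rfl
      rw [h4] at h2
      nlinarith
  have hLS : ∀ ψ, |L ψ| ≤ C / c * ‖S ψ‖ := by
    intro ψ
    refine (hL ψ).trans ?_
    rw [div_mul_eq_mul_div, le_div_iff₀ hc]
    nlinarith [hbd ψ]
  -- The bound of `L` by `S` makes `L ψ` a bounded linear function of `S ψ`. Hahn–Banach extends it
  -- to `M` without increasing the norm, and Riesz represents it.
  have hker : LinearMap.ker S ≤ LinearMap.ker L := by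
    intro ψ hψ
    rw [LinearMap.mem_ker] at hψ ⊢
    have := hLS ψ
    rw [hψ, norm_zero, mul_zero] at this
    exact abs_nonpos_iff.mp this
  let l : LinearMap.range S →ₗ[ℝ] ℝ :=
    (LinearMap.ker S).liftQ L hker ∘ₗ S.quotKerEquivRange.symm.toLinearMap
  have hl : ∀ ψ, l ⟨S ψ, ψ, rfl⟩ = L ψ := by
    intro ψ
    have : S.quotKerEquivRange.symm ⟨S ψ, ψ, rfl⟩ = Submodule.Quotient.mk ψ := by
      rw [LinearEquiv.symm_apply_eq]
      rfl
    simp only [l, LinearMap.comp_apply, LinearEquiv.coe_coe, this]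
    rfl
  have hlb : ∀ y, ‖l y‖ ≤ C / c * ‖y‖ := by
    rintro ⟨_, ψ, rfl⟩
    rw [hl]
    exact hLS ψ
  obtain ⟨g, hg1, hg2⟩ := exists_extension_norm_eq (LinearMap.range S)
    (l.mkContinuous (C / c) hlb)
  refine ⟨((InnerProductSpace.toDual ℝ M).symm g : M), Subtype.mem _, ?_, fun ψ => ?_⟩
  · change ‖(InnerProductSpace.toDual ℝ M).symm g‖ ≤ _
    rw [LinearIsometryEquiv.norm_map, hg2]
    exact LinearMap.mkContinuous_norm_le _ (by positivity) _
  · rw [← hS, real_inner_comm, InnerProductSpace.toDual_symm_apply]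
    have := hg1 ⟨S ψ, ψ, rfl⟩
    rw [LinearMap.mkContinuous_apply, hl] at this
    exact this

end Lions

/-! ### Operators on L₂(0,τ; X) and weighted energy identities -/

namespace L2Time

set_option linter.unusedSectionVars false

variable {X Y : Type} [NormedAddCommGroup X] [InnerProductSpace ℝ X]
  [NormedAddCommGroup Y] [InnerProductSpace ℝ Y] {τ : ℝ}

theorem norm_sq_eq_integral (f : L2Time τ X) : ‖f‖ ^ 2 = ∫ t in Ioo 0 τ, ‖f t‖ ^ 2 := by
  rw [← real_inner_self_eq_norm_sq, L2.inner_def]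
  simp only [real_inner_self_eq_norm_sq]

theorem integrable (f : L2Time τ X) : IntegrableOn f (Ioo 0 τ) :=
  (Lp.memLp f).integrable one_le_two

theorem intervalIntegrable (f : L2Time τ X) {t : ℝ} (ht : t ∈ Icc 0 τ) :
    IntervalIntegrable f volume 0 t := by
  rw [intervalIntegrable_iff_integrableOn_Ioo_of_le ht.1]
  exact f.integrable.mono_set (Ioo_subset_Ioo_right ht.2)

theorem integral_norm_le (f : L2Time τ X) : ∫ t in Ioo 0 τ, ‖f t‖ ≤ √τ * ‖f‖ := by
  rcases lt_or_ge 0 τ with hτ | hτ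
  · have h1 : ∫ t in Ioo 0 τ, ‖f t‖ * 1 ≤
        (∫ t in Ioo 0 τ, ‖f t‖ ^ (2 : ℝ)) ^ (1 / (2 : ℝ)) *
          (∫ t in Ioo 0 τ, (1 : ℝ) ^ (2 : ℝ)) ^ (1 / (2 : ℝ)) := by
      refine integral_mul_le_Lp_mul_Lq_of_nonneg Real.HolderConjugate.two_two
        (.of_forall fun _ => norm_nonneg _) (.of_forall fun _ => zero_le_one) ?_ ?_
      · simpa using (Lp.memLp f).norm
      · simpa using memLp_const (1 : ℝ)
    simp only [mul_one, Real.rpow_two, ← norm_sq_eq_integral, one_pow, integral_const,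
      ← Real.sqrt_eq_rpow, Real.sqrt_sq (norm_nonneg f)] at h1
    rw [mul_comm]
    simpa [hτ.le] using h1
  · rw [setIntegral_measure_zero _ (by simp [hτ])]
    positivity

/-- Cauchy–Schwarz in time. The factor √τ is what keeps a solution near its initial value for short
times. -/
theorem norm_integral_le (f : L2Time τ X) {t : ℝ} (ht : t ∈ Icc 0 τ) :
    ‖∫ s in (0 : ℝ)..t, f s‖ ≤ √τ * ‖f‖ := by
  refine le_trans ?_ f.integral_norm_le
  rw [intervalIntegral.integral_of_le ht.1, integral_Ioc_eq_integral_Ioo]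
  exact (norm_integral_le_integral_norm _).trans
    (setIntegral_mono_set f.integrable.norm (.of_forall fun _ => norm_nonneg _)
      (Ioo_subset_Ioo_right ht.2).eventuallyLE)

theorem intervalIntegral_congr {f g : ℝ → X} (h : ∀ᵐ t ∂(volume.restrict (Ioo 0 τ)), f t = g t)
    {t : ℝ} (ht : t ∈ Icc 0 τ) : ∫ s in (0 : ℝ)..t, f s = ∫ s in (0 : ℝ)..t, g s := by
  rw [intervalIntegral.integral_of_le ht.1, intervalIntegral.integral_of_le ht.1,
    integral_Ioc_eq_integral_Ioo, integral_Ioc_eq_integral_Ioo]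
  exact integral_congr_ae (ae_restrict_of_ae_restrict_of_subset (Ioo_subset_Ioo_right ht.2) h)

theorem intervalIntegral_add (f g : L2Time τ X) {t : ℝ} (ht : t ∈ Icc 0 τ) :
    ∫ s in (0 : ℝ)..t, (f + g) s = (∫ s in (0 : ℝ)..t, f s) + ∫ s in (0 : ℝ)..t, g s := by
  rw [← intervalIntegral.integral_add (f.intervalIntegrable ht) (g.intervalIntegrable ht)]
  exact intervalIntegral_congr (Lp.coeFn_add f g) ht

theorem intervalIntegral_smul (c : ℝ) (f : L2Time τ X) {t : ℝ} (ht : t ∈ Icc 0 τ) :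
    ∫ s in (0 : ℝ)..t, (c • f) s = c • ∫ s in (0 : ℝ)..t, f s := by
  rw [← intervalIntegral.integral_smul]
  exact intervalIntegral_congr (Lp.coeFn_smul c f) ht

theorem continuousOn_primitive (x₀ : X) (f : L2Time τ X) :
    ContinuousOn (fun t => x₀ + ∫ s in (0 : ℝ)..t, f s) (Icc 0 τ) := by
  rcases lt_or_ge τ 0 with hτ | hτ
  · simp [Icc_eq_empty hτ.not_ge]
  · have := (absolutelyContinuousOnInterval_primitive x₀
      (f.intervalIntegrable ⟨hτ, le_rfl⟩)).continuousOn
    rwa [uIcc_of_le hτ] at this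

theorem memLp_primitive (f : L2Time τ X) :
    MemLp (fun t => ∫ s in (0 : ℝ)..t, f s) 2 (volume.restrict (Ioo 0 τ)) := by
  refine MemLp.of_bound ?_ (√τ * ‖f‖) ?_
  · have h := (f.continuousOn_primitive 0).mono Ioo_subset_Icc_self
    simp only [zero_add] at h
    exact h.aestronglyMeasurable measurableSet_Ioo
  · filter_upwards [ae_restrict_mem measurableSet_Ioo] with t ht
    exact f.norm_integral_le (Ioo_subset_Icc_self ht)

theorem ae_mem_Icc : ∀ᵐ t ∂(volume.restrict (Ioo 0 τ)), t ∈ Icc 0 τ := by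
  filter_upwards [ae_restrict_mem measurableSet_Ioo] with t ht using Ioo_subset_Icc_self ht

variable (τ X) in
/-- The Volterra operator `f ↦ ∫₀ᵗ f` on `L₂(0,τ; X)`. -/
noncomputable def primitive : L2Time τ X →L[ℝ] L2Time τ X :=
  LinearMap.mkContinuous
    { toFun := fun f => f.memLp_primitive.toLp _
      map_add' := fun f g => by
        ext1
        filter_upwards [(f + g).memLp_primitive.coeFn_toLp, f.memLp_primitive.coeFn_toLp,
          g.memLp_primitive.coeFn_toLp, Lp.coeFn_add (f.memLp_primitive.toLp _)
          (g.memLp_primitive.toLp _), ae_mem_Icc] with t h1 h2 h3 h4 ht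
        rw [h4, h1, Pi.add_apply, h2, h3, intervalIntegral_add f g ht]
      map_smul' := fun c f => by
        ext1
        filter_upwards [(c • f).memLp_primitive.coeFn_toLp, f.memLp_primitive.coeFn_toLp,
          Lp.coeFn_smul c (f.memLp_primitive.toLp _), ae_mem_Icc] with t h1 h2 h4 ht
        rw [RingHom.id_apply, h4, h1, Pi.smul_apply, h2, intervalIntegral_smul c f ht] }
    (((measureUnivNNReal (volume.restrict (Ioo 0 τ)) : ℝ) ^ (2 : ENNReal).toReal⁻¹) * √τ)
    (fun f => by
      rw [mul_assoc]
      refine Lp.norm_le_of_ae_bound (by positivity) ?_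
      filter_upwards [f.memLp_primitive.coeFn_toLp, ae_mem_Icc] with t h1 ht
      refine (congrArg norm h1).trans_le (f.norm_integral_le ht))

theorem coeFn_primitive (f : L2Time τ X) :
    ∀ᵐ t ∂(volume.restrict (Ioo 0 τ)), primitive X τ f t = ∫ s in (0 : ℝ)..t, f s :=
  f.memLp_primitive.coeFn_toLp

/-- The map `f ↦ ∫₀^τ f` on `L₂(0,τ; X)`. -/
noncomputable def total (hτ : 0 ≤ τ) : L2Time τ X →L[ℝ] X :=
  LinearMap.mkContinuous
    { toFun := fun f => ∫ s in (0 : ℝ)..τ, f s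
      map_add' := fun f g => intervalIntegral_add f g ⟨hτ, le_rfl⟩
      map_smul' := fun c f => intervalIntegral_smul c f ⟨hτ, le_rfl⟩ }
    (√τ) (fun f => f.norm_integral_le ⟨hτ, le_rfl⟩)

theorem total_apply (hτ : 0 ≤ τ) (f : L2Time τ X) : total hτ f = ∫ s in (0 : ℝ)..τ, f s := rfl

theorem memLp_smul {h : ℝ → ℝ} (hh : ContinuousOn h (Icc 0 τ)) (f : L2Time τ X) :
    MemLp (fun t => h t • f t) 2 (volume.restrict (Ioo 0 τ)) := by
  obtain ⟨C, hC⟩ := isCompact_Icc.exists_bound_of_continuousOn hh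
  refine (Lp.memLp f).of_le_mul (c := C) ?_ ?_
  · exact ((hh.mono Ioo_subset_Icc_self).aestronglyMeasurable measurableSet_Ioo).smul
      (Lp.aestronglyMeasurable f)
  · filter_upwards [ae_mem_Icc] with t ht
    rw [norm_smul]
    exact mul_le_mul_of_nonneg_right (hC t ht) (norm_nonneg _)

/-- Multiplication by a continuous function of time. -/
noncomputable def mulLeft {h : ℝ → ℝ} (hh : ContinuousOn h (Icc 0 τ)) :
    L2Time τ X →ₗ[ℝ] L2Time τ X where
  toFun f := (memLp_smul hh f).toLp _
  map_add' f g := by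
    ext1
    filter_upwards [(memLp_smul hh (f + g)).coeFn_toLp, (memLp_smul hh f).coeFn_toLp,
      (memLp_smul hh g).coeFn_toLp, Lp.coeFn_add ((memLp_smul hh f).toLp _)
      ((memLp_smul hh g).toLp _), Lp.coeFn_add f g] with t h1 h2 h3 h4 h5
    rw [h4, h1, Pi.add_apply, h2, h3, h5, Pi.add_apply, smul_add]
  map_smul' c f := by
    ext1
    filter_upwards [(memLp_smul hh (c • f)).coeFn_toLp, (memLp_smul hh f).coeFn_toLp,
      Lp.coeFn_smul c ((memLp_smul hh f).toLp _), Lp.coeFn_smul c f] with t h1 h2 h4 h5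
    rw [RingHom.id_apply, h4, h1, Pi.smul_apply, h2, h5, Pi.smul_apply, smul_comm]

theorem coeFn_mulLeft {h : ℝ → ℝ} (hh : ContinuousOn h (Icc 0 τ)) (f : L2Time τ X) :
    ∀ᵐ t ∂(volume.restrict (Ioo 0 τ)), mulLeft hh f t = h t • f t :=
  (memLp_smul hh f).coeFn_toLp

theorem norm_mulLeft_le {h : ℝ → ℝ} (hh : ContinuousOn h (Icc 0 τ)) {C : ℝ}
    (hC : ∀ t ∈ Icc 0 τ, |h t| ≤ C) (f : L2Time τ X) : ‖mulLeft hh f‖ ≤ C * ‖f‖ := by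
  refine Lp.norm_le_mul_norm_of_ae_le_mul ?_
  filter_upwards [coeFn_mulLeft hh f, ae_mem_Icc] with t h1 ht
  rw [h1, norm_smul]
  exact mul_le_mul_of_nonneg_right (hC t ht) (norm_nonneg _)

theorem inner_compLpL [CompleteSpace X] [CompleteSpace Y] (A : X →L[ℝ] Y) (f : L2Time τ X)
    (g : L2Time τ Y) : inner ℝ g (A.compLpL 2 (volume.restrict (Ioo 0 τ)) f)
      = inner ℝ ((A.adjoint).compLpL 2 (volume.restrict (Ioo 0 τ)) g) f := by
  rw [L2.inner_def, L2.inner_def]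
  refine integral_congr_ae ?_
  filter_upwards [A.coeFn_compLpL f, A.adjoint.coeFn_compLpL g] with t h1 h2
  rw [h1, h2, ContinuousLinearMap.adjoint_inner_left]

theorem compLpL_primitive [CompleteSpace X] [CompleteSpace Y] (A : X →L[ℝ] Y) (f : L2Time τ X) :
    A.compLpL 2 (volume.restrict (Ioo 0 τ)) (primitive X τ f)
      = primitive Y τ (A.compLpL 2 (volume.restrict (Ioo 0 τ)) f) := by
  ext1
  filter_upwards [A.coeFn_compLpL (primitive X τ f), coeFn_primitive f,
    coeFn_primitive (A.compLpL 2 (volume.restrict (Ioo 0 τ)) f), ae_mem_Icc] with t h1 h2 h3 ht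
  rw [h1, h2, h3, intervalIntegral_congr (A.coeFn_compLpL f) ht]
  exact (A.intervalIntegral_comp_comm (f.intervalIntegrable ht)).symm

/-- The weight `2 - t/τ` used in the energy estimates. -/
noncomputable def weight (τ t : ℝ) : ℝ := 2 - t / τ

theorem contDiff_weight : ContDiff ℝ 1 (weight τ) :=
  contDiff_const.sub (contDiff_id.div_const τ)

theorem continuousOn_weight : ContinuousOn (weight τ) (Icc 0 τ) :=
  contDiff_weight.continuous.continuousOn

theorem deriv_weight (t : ℝ) : deriv (weight τ) t = -τ⁻¹ := by
  have : HasDerivAt (weight τ) (0 - 1 / τ) t :=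
    (hasDerivAt_const t (2 : ℝ)).sub ((hasDerivAt_id t).div_const τ)
  rw [this.deriv]
  simp

theorem weight_mem (hτ : 0 < τ) {t : ℝ} (ht : t ∈ Icc 0 τ) :
    1 ≤ weight τ t ∧ weight τ t ≤ 2 := by
  have h1 : t / τ ≤ 1 := (div_le_one hτ).mpr ht.2
  have h2 : 0 ≤ t / τ := div_nonneg ht.1 hτ.le
  constructor <;> unfold weight <;> linarith

/-- With P the primitive of `g`, the left side is half the integral of w (‖P‖²)'. Integrating by
parts, w(τ) = 1 gives the endpoint term and w' = -1/τ the bulk term; a constant weight would give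
only the former. -/
theorem inner_weight_primitive [CompleteSpace X] (hτ : 0 < τ) (g : L2Time τ X) :
    inner ℝ (mulLeft continuousOn_weight g) (primitive X τ g)
      = 1 / 2 * ‖total hτ.le g‖ ^ 2 + 1 / (2 * τ) * ‖primitive X τ g‖ ^ 2 := by
  have hg := g.intervalIntegrable (right_mem_Icc.mpr hτ.le)
  have h := integral_energy_primitive 0 hg (contDiff_weight (τ := τ))
  simp only [zero_add, deriv_weight] at h
  rw [intervalIntegral.integral_of_le hτ.le, integral_Ioc_eq_integral_Ioo] at h
  have e : ∀ᵐ t ∂(volume.restrict (Ioo 0 τ)),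
      weight τ t * (2 * inner ℝ (∫ s in (0 : ℝ)..t, g s) (g t)) + -τ⁻¹ * ‖∫ s in (0 : ℝ)..t, g s‖ ^ 2
      = 2 * inner ℝ (mulLeft continuousOn_weight g t) (primitive X τ g t)
        + -τ⁻¹ * inner ℝ (primitive X τ g t) (primitive X τ g t) := by
    filter_upwards [coeFn_primitive g, coeFn_mulLeft continuousOn_weight g] with t h1 h2
    rw [h1, h2, real_inner_smul_left, real_inner_self_eq_norm_sq, real_inner_comm (g t)]
    ring
  rw [integral_congr_ae e, integral_add ((L2.integrable_inner _ _).const_mul 2)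
    ((L2.integrable_inner _ _).const_mul _), integral_const_mul, integral_const_mul,
    ← L2.inner_def, ← L2.inner_def, real_inner_self_eq_norm_sq] at h
  have w1 : weight τ τ = 1 := by unfold weight; field_simp; norm_num
  rw [w1, norm_zero, ← total_apply hτ.le] at h
  have : 1 / (2 * τ) = 1 / 2 * τ⁻¹ := by field_simp
  rw [this]
  linarith

/-- Integration by parts gives ∫ w g = ∫ g + τ⁻¹ ∫ P with P the primitive of `g`. Only the two
quantities controlled by `inner_weight_primitive` appear, not the norm of `g`, which the coercivity
estimate does not control. -/
theorem abs_inner_weight_const_le [CompleteSpace X] (hτ : 0 < τ) (x₀ : X) (g : L2Time τ X) :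
    |inner ℝ (mulLeft continuousOn_weight (Lp.const 2 (volume.restrict (Ioo 0 τ)) x₀)) g|
      ≤ ‖x₀‖ * (‖total hτ.le g‖ + (√τ)⁻¹ * ‖primitive X τ g‖) := by
  have hg := g.intervalIntegrable (right_mem_Icc.mpr hτ.le)
  have hI : IntervalIntegrable (fun t => ∫ s in (0 : ℝ)..t, g s) volume 0 τ := by
    rw [intervalIntegrable_iff_integrableOn_Ioo_of_le hτ.le]
    exact g.memLp_primitive.integrable one_le_two
  have hI' : IntervalIntegrable (fun t => -τ⁻¹ • ∫ s in (0 : ℝ)..t, g s) volume 0 τ := hI.smul _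
  have h := integral_smul_primitive 0 hg (contDiff_weight (τ := τ))
  have w1 : weight τ τ = 1 := by unfold weight; field_simp; norm_num
  simp only [zero_add, deriv_weight, w1, smul_zero, sub_zero, one_smul] at h
  rw [intervalIntegral.integral_add
    (hg.continuousOn_smul contDiff_weight.continuous.continuousOn)
    hI', intervalIntegral.integral_smul, ← total_apply hτ.le] at h
  have e : inner ℝ (mulLeft continuousOn_weight (Lp.const 2 (volume.restrict (Ioo 0 τ)) x₀)) g
      = inner ℝ x₀ (∫ t in (0 : ℝ)..τ, weight τ t • g t) := by
    rw [intervalIntegral.integral_of_le hτ.le, integral_Ioc_eq_integral_Ioo, L2.inner_def,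
      ← integral_inner (memLp_smul continuousOn_weight g |>.integrable one_le_two)]
    refine integral_congr_ae ?_
    filter_upwards [coeFn_mulLeft continuousOn_weight
      (Lp.const 2 (volume.restrict (Ioo 0 τ)) x₀), Lp.coeFn_const (p := 2)
      (μ := volume.restrict (Ioo 0 τ)) x₀] with t h1 h2
    rw [h1, h2, Function.const_apply, real_inner_smul_left, real_inner_smul_right]
  have h3 : ‖∫ t in (0 : ℝ)..τ, ∫ s in (0 : ℝ)..t, g s‖ ≤ √τ * ‖primitive X τ g‖ := by
    rw [← intervalIntegral_congr (coeFn_primitive g) (right_mem_Icc.mpr hτ.le)]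
    exact norm_integral_le _ (right_mem_Icc.mpr hτ.le)
  rw [e, eq_sub_of_add_eq h, neg_smul, sub_neg_eq_add]
  refine (abs_real_inner_le_norm _ _).trans (mul_le_mul_of_nonneg_left ?_ (norm_nonneg _))
  refine (norm_add_le _ _).trans (add_le_add le_rfl ?_)
  rw [norm_smul, Real.norm_of_nonneg (by positivity)]
  refine (mul_le_mul_of_nonneg_left h3 (by positivity)).trans_eq ?_
  have : √τ * √τ = τ := Real.mul_self_sqrt hτ.le
  have h0 : 0 < √τ := Real.sqrt_pos.mpr hτ
  field_simp
  rw [sq, this]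

end L2Time

/-! ### The linear problem with a prescribed coefficient -/

section LinearProblem

set_option linter.unusedSectionVars false

variable {H V W : Type} [NormedAddCommGroup H] [InnerProductSpace ℝ H] [CompleteSpace H]
  [NormedAddCommGroup V] [InnerProductSpace ℝ V] [CompleteSpace V]
  [NormedAddCommGroup W] [InnerProductSpace ℝ W] [CompleteSpace W]

open L2Time

/-- The abstract linear evolution problem `u' + a(t) G*G u = F`, `u(0) = u₀`, for a Gelfand-type
pair `ι : V → H` with energy `‖G v‖²`. -/
structure IsEvolution {τ : ℝ} (ι : V →L[ℝ] H) (G : V →L[ℝ] W) (a : ℝ → ℝ) (x₀ : H) (F : ℝ → H)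
    (u : L2Time τ V) (p : L2Time τ H) : Prop where
  primitive : ∀ᵐ t ∂(volume.restrict (Ioo 0 τ)), ι (u t) = x₀ + ∫ s in (0 : ℝ)..t, p s
  weak : ∀ᵐ t ∂(volume.restrict (Ioo 0 τ)), ∀ w : V,
    inner ℝ (p t) (ι w) + a t * inner ℝ (G (u t)) (G w) = inner ℝ (F t) (ι w)

theorem norm_sq_compLpL_add {τ : ℝ} {ι : V →L[ℝ] H} {G : V →L[ℝ] W}
    (hV : ∀ v, ‖v‖ ^ 2 = ‖ι v‖ ^ 2 + ‖G v‖ ^ 2) (u : L2Time τ V) :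
    ‖u‖ ^ 2 = ‖ι.compLpL 2 (volume.restrict (Ioo 0 τ)) u‖ ^ 2
      + ‖G.compLpL 2 (volume.restrict (Ioo 0 τ)) u‖ ^ 2 := by
  simp only [← real_inner_self_eq_norm_sq, L2.inner_def]
  rw [← integral_add (L2.integrable_inner _ _) (L2.integrable_inner _ _)]
  refine integral_congr_ae ?_
  filter_upwards [ι.coeFn_compLpL u, G.coeFn_compLpL u] with t h1 h2
  rw [h1, h2]
  simp only [real_inner_self_eq_norm_sq, hV]

/-- The pair (ι, G) is an isometry of a complete space. This is used to recognise a limit of pairs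
(ι v, G v) as coming from an element of L₂(0,τ; V). -/
theorem isClosed_range_compLpL_prod {τ : ℝ} {ι : V →L[ℝ] H} {G : V →L[ℝ] W}
    (hV : ∀ v, ‖v‖ ^ 2 = ‖ι v‖ ^ 2 + ‖G v‖ ^ 2) :
    IsClosed (range fun u : L2Time τ V =>
      WithLp.toLp 2 (ι.compLpL 2 (volume.restrict (Ioo 0 τ)) u,
        G.compLpL 2 (volume.restrict (Ioo 0 τ)) u)) := by
  let Θ : L2Time τ V →ₗ[ℝ] WithLp 2 (L2Time τ H × L2Time τ W) :=
    (WithLp.linearEquiv 2 ℝ _).symm.toLinearMap ∘ₗ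
      (((ι.compLpL 2 (volume.restrict (Ioo 0 τ))).toLinearMap).prod
        (G.compLpL 2 (volume.restrict (Ioo 0 τ))).toLinearMap)
  have hΘ : ∀ u, ‖Θ u‖ = ‖u‖ := fun u => by
    rw [← sq_eq_sq₀ (norm_nonneg _) (norm_nonneg _), norm_sq_compLpL_add hV,
      WithLp.prod_norm_sq_eq_of_L2]
    rfl
  have hiso : Isometry Θ := AddMonoidHomClass.isometry_of_norm Θ hΘ
  exact hiso.isClosedEmbedding.isClosed_range

/-- Solvability of the linear problem, with bounds that improve as `τ → 0`. -/
theorem exists_isEvolution {τ : ℝ} (hτ : 0 < τ) {ι : V →L[ℝ] H} {G : V →L[ℝ] W}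
    (hV : ∀ v, ‖v‖ ^ 2 = ‖ι v‖ ^ 2 + ‖G v‖ ^ 2) {a : ℝ → ℝ} (ha : ContinuousOn a (Icc 0 τ))
    {α β : ℝ} (hα : 0 < α) (haα : ∀ t ∈ Icc 0 τ, α ≤ a t) (haβ : ∀ t ∈ Icc 0 τ, a t ≤ β)
    (u₀ : V) (F : L2Time τ H) {D : ℝ}
    (hD : (2 / α * ‖F‖ + 2 * ‖G u₀‖) / min (1 / β) (1 / 2) ≤ D) :
    ∃ (u : L2Time τ V) (p : L2Time τ H), IsEvolution ι G a (ι u₀) F u p ∧ ‖p‖ ≤ D ∧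
      ‖G.compLpL 2 (volume.restrict (Ioo 0 τ)) u‖ ≤ √τ * (D + ‖G u₀‖) := by
  have hβ : 0 < β := hα.trans_le ((haα 0 ⟨le_rfl, hτ.le⟩).trans (haβ 0 ⟨le_rfl, hτ.le⟩))
  have hs : 0 < √τ := Real.sqrt_pos.mpr hτ
  set μ := (volume : Measure ℝ).restrict (Ioo 0 τ) with hμ
  have hapos : ∀ t ∈ Icc 0 τ, 0 < a t := fun t ht => hα.trans_le (haα t ht)
  -- The equation is multiplied by w/a, which leaves only the explicit weight w in front of the
  -- elliptic term.
  have hh : ContinuousOn (fun t => weight τ t / a t) (Icc 0 τ) :=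
    continuousOn_weight.div ha fun t ht => (hapos t ht).ne'
  let ιV := ι.compLpL 2 μ
  let GV := G.compLpL 2 μ
  let c₀ : L2Time τ W := Lp.const 2 μ (G u₀)
  let A : L2Time τ H →ₗ[ℝ] L2Time τ H := mulLeft hh
  let R : L2Time τ W →ₗ[ℝ] L2Time τ W := mulLeft continuousOn_weight
  let P := WithLp 2 (L2Time τ H × WithLp 2 (L2Time τ W × W))
  -- Here ψ plays the role of u_t. The unknown in `P` has first component u_t and second component
  -- G(u - u₀)/√τ; this scaling makes the coercivity constant of the second component independent of
  -- τ. The third component is not tested by `K` and serves to bound the endpoint term in `L`.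
  let J : L2Time τ V →ₗ[ℝ] P := (WithLp.linearEquiv 2 ℝ _).symm.toLinearMap ∘ₗ
    (ιV.toLinearMap.prod ((WithLp.linearEquiv 2 ℝ _).symm.toLinearMap ∘ₗ
      (((√τ)⁻¹ • (L2Time.primitive W τ ∘L GV).toLinearMap).prod (total hτ.le ∘L GV).toLinearMap)))
  let K : L2Time τ V →ₗ[ℝ] P := (WithLp.linearEquiv 2 ℝ _).symm.toLinearMap ∘ₗ
    ((A ∘ₗ ιV.toLinearMap).prod ((WithLp.linearEquiv 2 ℝ _).symm.toLinearMap ∘ₗ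
      ((√τ • (R ∘ₗ GV.toLinearMap)).prod 0)))
  let L : L2Time τ V →ₗ[ℝ] ℝ :=
    ((innerSL ℝ (A F)) ∘L ιV - (innerSL ℝ (R c₀)) ∘L GV).toLinearMap
  have hJn : ∀ ψ, ‖J ψ‖ ^ 2 = ‖ιV ψ‖ ^ 2 +
      (((√τ)⁻¹ * ‖L2Time.primitive W τ (GV ψ)‖) ^ 2 + ‖total hτ.le (GV ψ)‖ ^ 2) := by
    intro ψ
    rw [WithLp.prod_norm_sq_eq_of_L2, WithLp.prod_norm_sq_eq_of_L2]
    have : ‖(√τ)⁻¹ • L2Time.primitive W τ (GV ψ)‖ = (√τ)⁻¹ * ‖L2Time.primitive W τ (GV ψ)‖ := by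
      rw [norm_smul, Real.norm_of_nonneg (by positivity)]
    rw [← this]
    rfl
  have hK : ∀ ψ (y : P), inner ℝ (K ψ) y
      = inner ℝ (A (ιV ψ)) y.fst + √τ * inner ℝ (R (GV ψ)) y.snd.fst := by
    intro ψ y
    rw [WithLp.prod_inner_apply, WithLp.prod_inner_apply]
    change inner ℝ (A (ιV ψ)) y.fst + (inner ℝ (√τ • R (GV ψ)) y.snd.fst
      + inner ℝ (0 : W) y.snd.snd) = _
    rw [inner_zero_left, add_zero, real_inner_smul_left]
  have hKJ : ∀ ψ, inner ℝ (K ψ) (J ψ)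
      = inner ℝ (A (ιV ψ)) (ιV ψ) + inner ℝ (R (GV ψ)) (L2Time.primitive W τ (GV ψ)) := by
    intro ψ
    rw [hK]
    change _ + √τ * inner ℝ (R (GV ψ)) ((√τ)⁻¹ • L2Time.primitive W τ (GV ψ)) = _
    rw [real_inner_smul_right, mul_inv_cancel_left₀ hs.ne']
    rfl
  have hA1 : ∀ g : L2Time τ H, 1 / β * ‖g‖ ^ 2 ≤ inner ℝ (A g) g := by
    intro g
    rw [← real_inner_self_eq_norm_sq, L2.inner_def, L2.inner_def, ← integral_const_mul]
    refine integral_mono_ae ((L2.integrable_inner _ _).const_mul _) (L2.integrable_inner _ _) ?_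
    filter_upwards [coeFn_mulLeft hh g, ae_mem_Icc] with t h1 ht
    change _ ≤ inner ℝ (mulLeft hh g t) (g t)
    rw [h1, real_inner_smul_left]
    refine mul_le_mul_of_nonneg_right ?_ real_inner_self_nonneg
    exact div_le_div₀ (zero_le_one.trans (weight_mem hτ ht).1) (weight_mem hτ ht).1
      (hapos t ht) (haβ t ht)
  have hA2 : ‖A F‖ ≤ 2 / α * ‖F‖ := by
    refine norm_mulLeft_le hh (fun t ht => ?_) F
    have hw := weight_mem hτ ht
    rw [abs_of_nonneg (div_nonneg (by linarith) (hapos t ht).le)]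
    exact div_le_div₀ zero_le_two hw.2 hα (haα t ht)
  set c := min (1 / β) (1 / 2) with hc
  have hcpos : 0 < c := lt_min (by positivity) (by norm_num)
  have hc1 : c ≤ 1 / β := min_le_left _ _
  have hc2 : c ≤ 1 / 2 := min_le_right _ _
  obtain ⟨y, hy, hyn, hyL⟩ := exists_mem_closure_range_of_coercive J K L
    (c := c) (C := 2 / α * ‖F‖ + 2 * ‖G u₀‖) hcpos (by positivity) (by
      intro ψ
      rw [hKJ, inner_weight_primitive hτ, hJn]
      have e : 1 / (2 * τ) * ‖L2Time.primitive W τ (GV ψ)‖ ^ 2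
          = 1 / 2 * ((√τ)⁻¹ * ‖L2Time.primitive W τ (GV ψ)‖) ^ 2 := by
        rw [mul_pow, inv_pow, Real.sq_sqrt hτ.le]
        field_simp
      rw [e]
      have h1 := hA1 (ιV ψ)
      have h2 := mul_le_mul_of_nonneg_right hc1 (sq_nonneg ‖ιV ψ‖)
      have h3 := mul_le_mul_of_nonneg_right hc2
        (sq_nonneg ((√τ)⁻¹ * ‖L2Time.primitive W τ (GV ψ)‖))
      have h4 := mul_le_mul_of_nonneg_right hc2 (sq_nonneg ‖total hτ.le (GV ψ)‖)
      linarith) (by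
      intro ψ
      have h1 : ‖ιV ψ‖ ≤ ‖J ψ‖ := by
        refine abs_le_of_sq_le_sq' ?_ (norm_nonneg _) |>.2
        rw [hJn]; nlinarith [sq_nonneg ((√τ)⁻¹ * ‖L2Time.primitive W τ (GV ψ)‖),
          sq_nonneg ‖total hτ.le (GV ψ)‖]
      have h2 : (√τ)⁻¹ * ‖L2Time.primitive W τ (GV ψ)‖ ≤ ‖J ψ‖ := by
        refine abs_le_of_sq_le_sq' ?_ (norm_nonneg _) |>.2
        rw [hJn]; nlinarith [sq_nonneg ‖ιV ψ‖, sq_nonneg ‖total hτ.le (GV ψ)‖]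
      have h3 : ‖total hτ.le (GV ψ)‖ ≤ ‖J ψ‖ := by
        refine abs_le_of_sq_le_sq' ?_ (norm_nonneg _) |>.2
        rw [hJn]; nlinarith [sq_nonneg ‖ιV ψ‖,
          sq_nonneg ((√τ)⁻¹ * ‖L2Time.primitive W τ (GV ψ)‖)]
      change |inner ℝ (A F) (ιV ψ) - inner ℝ (R c₀) (GV ψ)| ≤ _
      calc |inner ℝ (A F) (ιV ψ) - inner ℝ (R c₀) (GV ψ)|
          ≤ |inner ℝ (A F) (ιV ψ)| + |inner ℝ (R c₀) (GV ψ)| := abs_sub _ _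
        _ ≤ 2 / α * ‖F‖ * ‖J ψ‖ + ‖G u₀‖ * (‖J ψ‖ + ‖J ψ‖) := by
            refine add_le_add ((abs_real_inner_le_norm _ _).trans ?_)
              ((abs_inner_weight_const_le hτ (G u₀) (GV ψ)).trans ?_)
            · exact mul_le_mul hA2 h1 (norm_nonneg _) (by positivity)
            · exact mul_le_mul_of_nonneg_left (add_le_add h3 h2) (norm_nonneg _)
        _ = (2 / α * ‖F‖ + 2 * ‖G u₀‖) * ‖J ψ‖ := by ring)
  replace hyn := hyn.trans hD
  -- The solution of the variational problem is only a limit of values of `J`. For y = J ψ the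
  -- displayed pair is the image under (ι, G) of the primitive of ψ, and this property survives
  -- limits because the range is closed.
  have hcl : y ∈ {y : P | WithLp.toLp 2 (L2Time.primitive H τ y.fst, √τ • y.snd.fst) ∈
      range fun u : L2Time τ V => WithLp.toLp 2 (ιV u, GV u)} := by
    refine closure_minimal ?_ ?_ hy
    · rintro _ ⟨ψ, rfl⟩
      refine ⟨L2Time.primitive V τ ψ, ?_⟩
      change WithLp.toLp 2 (ιV (L2Time.primitive V τ ψ), GV (L2Time.primitive V τ ψ)) =
        WithLp.toLp 2 (L2Time.primitive H τ (ιV ψ), √τ • (√τ)⁻¹ • L2Time.primitive W τ (GV ψ))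
      rw [smul_inv_smul₀ hs.ne', compLpL_primitive, compLpL_primitive]
    · have c1 : Continuous fun y : P => y.fst :=
        (WithLp.prod_continuous_ofLp 2 (L2Time τ H) (WithLp 2 (L2Time τ W × W))).fst
      have c2 : Continuous fun y : P => y.snd.fst :=
        (WithLp.prod_continuous_ofLp 2 (L2Time τ W) W).fst.comp
          (WithLp.prod_continuous_ofLp 2 (L2Time τ H) (WithLp 2 (L2Time τ W × W))).snd
      exact (isClosed_range_compLpL_prod hV).preimage ((WithLp.prod_continuous_toLp 2 _ _).comp
        (((L2Time.primitive H τ).continuous.comp c1).prodMk (c2.const_smul (√τ))))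
  obtain ⟨v, hv⟩ := hcl
  have hv1 : ιV v = L2Time.primitive H τ y.fst := congrArg WithLp.fst hv
  have hv2 : GV v = √τ • y.snd.fst := congrArg WithLp.snd hv
  have hy1 : ‖y.fst‖ ≤ ‖y‖ ∧ ‖y.snd.fst‖ ≤ ‖y‖ := by
    have h := WithLp.prod_norm_sq_eq_of_L2 y
    rw [WithLp.prod_norm_sq_eq_of_L2 y.snd] at h
    constructor <;>
    · refine abs_le_of_sq_le_sq' ?_ (norm_nonneg _) |>.2
      rw [h]; nlinarith [sq_nonneg ‖y.fst‖, sq_nonneg ‖y.snd.fst‖, sq_nonneg ‖y.snd.snd‖]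
  let k₀ : L2Time τ V := Lp.const 2 μ u₀
  have hk₀ : ∀ᵐ t ∂μ, k₀ t = u₀ := Lp.coeFn_const (p := 2) (μ := μ) u₀
  have hc₀ : ∀ᵐ t ∂μ, c₀ t = G u₀ := Lp.coeFn_const (p := 2) (μ := μ) (G u₀)
  -- `Q` is the residual of the weighted equation as an element of L₂(0,τ; V). Its vanishing gives
  -- the weak form for all `w` at once, off a single null set of times.
  let Q : L2Time τ V := (ι.adjoint).compLpL 2 μ (A y.fst - A F) +
    (G.adjoint).compLpL 2 μ (R (GV v) + R c₀)
  have hQ : ∀ ψ : L2Time τ V, inner ℝ Q ψ = 0 := by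
    intro ψ
    have h1 := hyL ψ
    rw [hK] at h1
    change _ = inner ℝ (A F) (ιV ψ) - inner ℝ (R c₀) (GV ψ) at h1
    have hsymm : ∀ {X : Type} [NormedAddCommGroup X] [InnerProductSpace ℝ X] {h : ℝ → ℝ}
        (hh : ContinuousOn h (Icc 0 τ)) (f g : L2Time τ X),
        inner ℝ (mulLeft hh f) g = inner ℝ (mulLeft hh g) f := by
      intro X _ _ h hh f g
      rw [L2.inner_def, L2.inner_def]
      refine integral_congr_ae ?_
      filter_upwards [coeFn_mulLeft hh f, coeFn_mulLeft hh g] with t h1 h2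
      rw [h1, h2, real_inner_smul_left, real_inner_smul_left, real_inner_comm]
    rw [inner_add_left, ← inner_compLpL, ← inner_compLpL]
    change inner ℝ (A y.fst - A F) (ιV ψ) + inner ℝ (R (GV v) + R c₀) (GV ψ) = 0
    rw [inner_sub_left, inner_add_left, hv2, map_smul, real_inner_smul_left,
      hsymm hh y.fst (ιV ψ), hsymm continuousOn_weight y.snd.fst (GV ψ)]
    change inner ℝ (A (ιV ψ)) y.fst - _ + (√τ * inner ℝ (R (GV ψ)) y.snd.fst + _) = 0
    linarith
  have hQ0 : Q = 0 := inner_self_eq_zero.mp (hQ Q)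
  refine ⟨v + k₀, y.fst, ⟨?_, ?_⟩, hy1.1.trans hyn, ?_⟩
  · filter_upwards [Lp.coeFn_add v k₀, hk₀, ι.coeFn_compLpL v, coeFn_primitive y.fst]
      with t h1 h2 h3 h4
    change ιV v t = _ at h3
    rw [h1, Pi.add_apply, h2, map_add, ← h3, hv1, h4, add_comm]
  · have hQ0' : ∀ᵐ t ∂μ, Q t = 0 := by
      rw [hQ0]
      exact Lp.coeFn_zero V 2 μ
    filter_upwards [hQ0', Lp.coeFn_add ((ι.adjoint).compLpL 2 μ (A y.fst - A F))
      ((G.adjoint).compLpL 2 μ (R (GV v) + R c₀)), ι.adjoint.coeFn_compLpL (A y.fst - A F),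
      G.adjoint.coeFn_compLpL (R (GV v) + R c₀), Lp.coeFn_sub (A y.fst) (A F),
      Lp.coeFn_add (R (GV v)) (R c₀), coeFn_mulLeft hh y.fst, coeFn_mulLeft hh F,
      coeFn_mulLeft continuousOn_weight (GV v), coeFn_mulLeft continuousOn_weight c₀, hc₀,
      G.coeFn_compLpL v, Lp.coeFn_add v k₀, hk₀, ae_mem_Icc]
      with t h0 h1 h2 h3 h4 h5 h6 h7 h8 h9 h10 h11 h12 h13 ht w
    change (Q : ℝ → V) t = _ at h1
    change (GV v : ℝ → W) t = _ at h11
    change (A y.fst : ℝ → H) t = _ at h6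
    change (A F : ℝ → H) t = _ at h7
    change (R (GV v) : ℝ → W) t = _ at h8
    change (R c₀ : ℝ → W) t = _ at h9
    rw [h0, Pi.add_apply, h2, h3, h4, h5, Pi.sub_apply, Pi.add_apply, h6, h7, h8, h9, h10, h11]
      at h1
    have h14 := congrArg (fun z => inner ℝ z w) h1.symm
    simp only [inner_add_left, ContinuousLinearMap.adjoint_inner_left, inner_zero_left,
      inner_sub_left, real_inner_smul_left] at h14
    rw [h12, Pi.add_apply, h13, map_add, inner_add_left]
    have hw : 0 < weight τ t := zero_lt_one.trans_le (weight_mem hτ ht).1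
    have hat := hapos t ht
    have h15 : weight τ t / a t * (inner ℝ (y.fst t) (ι w) + a t * (inner ℝ (G (v t)) (G w)
        + inner ℝ (G u₀) (G w)) - inner ℝ (F t) (ι w)) = 0 := by
      refine Eq.trans ?_ h14
      field_simp
      ring
    rcases mul_eq_zero.mp h15 with h | h
    · exact absurd h (div_pos hw hat).ne'
    · linarith
  · change ‖GV (v + k₀)‖ ≤ _
    have hk : ‖GV k₀‖ ≤ √τ * ‖G u₀‖ := by
      have h1 : GV k₀ = c₀ := by
        ext1
        filter_upwards [G.coeFn_compLpL k₀, hk₀, hc₀] with t h1 h2 h3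
        rw [h3, ← h2]
        exact h1
      rw [h1, ← abs_of_nonneg (norm_nonneg c₀), ← abs_of_nonneg (show 0 ≤ √τ * ‖G u₀‖ by positivity)]
      rw [← sq_le_sq, norm_sq_eq_integral, mul_pow, Real.sq_sqrt hτ.le]
      have : ∫ t in Ioo 0 τ, ‖c₀ t‖ ^ 2 = ∫ t in Ioo 0 τ, ‖G u₀‖ ^ 2 := by
        refine integral_congr_ae ?_
        filter_upwards [hc₀] with t h
        rw [h]
      rw [this]
      simp [hτ.le]
    rw [map_add, mul_add]
    refine (norm_add_le _ _).trans (add_le_add ?_ hk)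
    rw [hv2, norm_smul, Real.norm_of_nonneg hs.le]
    exact mul_le_mul_of_nonneg_left (hy1.2.trans hyn) hs.le

end LinearProblem

/-! ### The nonlinear problem: contraction and uniqueness -/

section NonlinearProblem

set_option linter.unusedSectionVars false

variable {H V W : Type} [NormedAddCommGroup H] [InnerProductSpace ℝ H] [CompleteSpace H]
  [NormedAddCommGroup V] [InnerProductSpace ℝ V] [CompleteSpace V]
  [NormedAddCommGroup W] [InnerProductSpace ℝ W] [CompleteSpace W]
  {τ : ℝ} {ι : V →L[ℝ] H} {G : V →L[ℝ] W} {x₀ : H} {F : ℝ → H}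

open L2Time

theorem L2Time.norm_integral_sq (p : L2Time τ H) {t : ℝ} (ht : t ∈ Icc 0 τ) :
    ‖∫ s in (0 : ℝ)..t, p s‖ ^ 2
      = ∫ s in Ioo 0 t, 2 * inner ℝ (L2Time.primitive H τ p s) (p s) := by
  have h := integral_energy_primitive 0 (p.intervalIntegrable ht)
    (contDiff_const (c := (1 : ℝ)) (n := 1))
  simp only [zero_add, deriv_const, one_mul, zero_mul, add_zero, norm_zero, ne_eq,
    OfNat.ofNat_ne_zero, not_false_eq_true, zero_pow, sub_zero] at h
  rw [← h, intervalIntegral.integral_of_le ht.1, integral_Ioc_eq_integral_Ioo]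
  refine integral_congr_ae ?_
  filter_upwards [ae_restrict_of_ae_restrict_of_subset (Ioo_subset_Ioo_right ht.2)
    (coeFn_primitive p)] with s hs
  rw [hs]

/-- Test the difference of the equations with u₁ - u₂, writing a₁Gu₁ - a₂Gu₂ = a₁G(u₁ - u₂) + (a₁ -
a₂)Gu₂. Young's inequality absorbs half of the dissipation. The asymmetry matters: ellipticity is
required of a₁ only, and a gradient norm of u₂ only. -/
theorem IsEvolution.energy_sub_le {a₁ a₂ : ℝ → ℝ} {u₁ u₂ : L2Time τ V} {p₁ p₂ : L2Time τ H}
    (h₁ : IsEvolution ι G a₁ x₀ F u₁ p₁) (h₂ : IsEvolution ι G a₂ x₀ F u₂ p₂)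
    {t : ℝ} (ht : t ∈ Icc 0 τ) {α δ : ℝ} (hα : 0 < α) (ha : ∀ s ∈ Ioo 0 t, α ≤ a₁ s)
    (hδ : ∀ s ∈ Ioo 0 t, |a₁ s - a₂ s| ≤ δ) :
    ‖(∫ s in (0 : ℝ)..t, p₁ s) - ∫ s in (0 : ℝ)..t, p₂ s‖ ^ 2
      + α * ∫ s in Ioo 0 t, ‖G (u₁ s) - G (u₂ s)‖ ^ 2
      ≤ δ ^ 2 / α * ‖G.compLpL 2 (volume.restrict (Ioo 0 τ)) u₂‖ ^ 2 := by
  set μ := (volume : Measure ℝ).restrict (Ioo 0 τ) with hμ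
  have hsub : Ioo 0 t ⊆ Ioo 0 τ := Ioo_subset_Ioo_right ht.2
  let p : L2Time τ H := p₁ - p₂
  let g₁ : L2Time τ W := G.compLpL 2 μ u₁
  let g₂ : L2Time τ W := G.compLpL 2 μ u₂
  have hg₁ : ∀ᵐ s ∂μ, g₁ s = G (u₁ s) := G.coeFn_compLpL u₁
  have hg₂ : ∀ᵐ s ∂μ, g₂ s = G (u₂ s) := G.coeFn_compLpL u₂
  have hp : (∫ s in (0 : ℝ)..t, p₁ s) - ∫ s in (0 : ℝ)..t, p₂ s = ∫ s in (0 : ℝ)..t, p s := by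
    rw [← intervalIntegral.integral_sub (p₁.intervalIntegrable ht) (p₂.intervalIntegrable ht)]
    exact (intervalIntegral_congr (Lp.coeFn_sub p₁ p₂) ht).symm
  have i1 : IntegrableOn (fun s => ‖(g₁ - g₂) s‖ ^ 2) (Ioo 0 t) := by
    have := (L2.integrable_inner (𝕜 := ℝ) (g₁ - g₂) (g₁ - g₂))
    simp only [real_inner_self_eq_norm_sq] at this
    exact IntegrableOn.mono_set this hsub
  have i2' : IntegrableOn (fun s => ‖g₂ s‖ ^ 2) (Ioo 0 τ) := by
    have := (L2.integrable_inner (𝕜 := ℝ) g₂ g₂)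
    simp only [real_inner_self_eq_norm_sq] at this
    exact this
  have i2 : IntegrableOn (fun s => ‖g₂ s‖ ^ 2) (Ioo 0 t) := i2'.mono_set hsub
  have i3 : IntegrableOn (fun s => 2 * inner ℝ (L2Time.primitive H τ p s) (p s)) (Ioo 0 t) :=
    IntegrableOn.mono_set ((L2.integrable_inner (𝕜 := ℝ) (L2Time.primitive H τ p) p).const_mul 2)
      hsub
  have e1 : ∫ s in Ioo 0 t, ‖G (u₁ s) - G (u₂ s)‖ ^ 2 = ∫ s in Ioo 0 t, ‖(g₁ - g₂) s‖ ^ 2 := by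
    refine integral_congr_ae (ae_restrict_of_ae_restrict_of_subset hsub ?_)
    filter_upwards [hg₁, hg₂, Lp.coeFn_sub g₁ g₂] with s h1 h2 h3
    rw [h3, Pi.sub_apply, h1, h2]
  have e2 : ∫ s in Ioo 0 t, ‖g₂ s‖ ^ 2 ≤ ‖g₂‖ ^ 2 := by
    rw [norm_sq_eq_integral]
    exact setIntegral_mono_set i2' (.of_forall fun _ => sq_nonneg _) hsub.eventuallyLE
  have hmono : ∫ s in Ioo 0 t, 2 * inner ℝ (L2Time.primitive H τ p s) (p s)
      ≤ ∫ s in Ioo 0 t, (δ ^ 2 / α * ‖g₂ s‖ ^ 2 - α * ‖(g₁ - g₂) s‖ ^ 2) := by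
    refine integral_mono_ae i3 ((i2.const_mul _).sub (i1.const_mul _)) ?_
    have hae : ∀ᵐ s ∂μ, s ∈ Ioo 0 t →
        2 * inner ℝ (L2Time.primitive H τ p s) (p s)
          ≤ δ ^ 2 / α * ‖g₂ s‖ ^ 2 - α * ‖(g₁ - g₂) s‖ ^ 2 := by
      filter_upwards [h₁.primitive, h₂.primitive, h₁.weak, h₂.weak, coeFn_primitive p, hg₁, hg₂,
        Lp.coeFn_sub g₁ g₂, Lp.coeFn_sub p₁ p₂, ae_mem_Icc]
        with s q1 q2 w1 w2 hP e1 e2 e3 e4 hs hst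
      have hP' : L2Time.primitive H τ p s = ι (u₁ s - u₂ s) := by
        rw [hP, map_sub, q1, q2, add_sub_add_left_eq_sub,
          ← intervalIntegral.integral_sub (p₁.intervalIntegrable hs) (p₂.intervalIntegrable hs)]
        exact intervalIntegral_congr (Lp.coeFn_sub p₁ p₂) hs
      have w1' := w1 (u₁ s - u₂ s)
      have w2' := w2 (u₁ s - u₂ s)
      change p s = _ at e4
      rw [hP', e4, e3, Pi.sub_apply, Pi.sub_apply, e1, e2, real_inner_comm, inner_sub_left]
      rw [map_sub G] at w1' w2'
      set y := G (u₁ s) - G (u₂ s) with hy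
      have hGu : inner ℝ (G (u₁ s)) y = ‖y‖ ^ 2 + inner ℝ (G (u₂ s)) y := by
        rw [← real_inner_self_eq_norm_sq, ← inner_add_left, hy, sub_add_cancel]
      rw [hGu] at w1'
      have hyn := norm_nonneg y
      have hcs : |(a₁ s - a₂ s) * inner ℝ (G (u₂ s)) y| ≤ δ * (‖G (u₂ s)‖ * ‖y‖) := by
        rw [abs_mul]
        exact mul_le_mul (hδ s hst) (abs_real_inner_le_norm _ _) (abs_nonneg _)
          ((abs_nonneg _).trans (hδ s hst))
      have hcs' := (abs_le.mp hcs).1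
      have ha' := mul_le_mul_of_nonneg_right (ha s hst) (sq_nonneg ‖y‖)
      have hyoung : 2 * (δ * (‖G (u₂ s)‖ * ‖y‖)) ≤ δ ^ 2 / α * ‖G (u₂ s)‖ ^ 2 + α * ‖y‖ ^ 2 := by
        have : δ ^ 2 / α * ‖G (u₂ s)‖ ^ 2 + α * ‖y‖ ^ 2 - 2 * (δ * (‖G (u₂ s)‖ * ‖y‖))
            = (δ * ‖G (u₂ s)‖ - α * ‖y‖) ^ 2 / α := by
          field_simp
          ring
        have h0 : 0 ≤ (δ * ‖G (u₂ s)‖ - α * ‖y‖) ^ 2 / α := by positivity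
        linarith
      linarith
    filter_upwards [ae_restrict_of_ae_restrict_of_subset hsub hae,
      ae_restrict_mem measurableSet_Ioo] with s h1 h2 using h1 h2
  rw [← L2Time.norm_integral_sq p ht, integral_sub (i2.const_mul _) (i1.const_mul _),
    integral_const_mul, integral_const_mul] at hmono
  rw [hp, e1]
  have := mul_le_mul_of_nonneg_left e2 (show 0 ≤ δ ^ 2 / α by positivity)
  change _ ≤ δ ^ 2 / α * ‖g₂‖ ^ 2
  linarith

/-- The coefficient depends on ‖v‖ alone, so it suffices to clamp ‖v‖ to [‖x₀‖/2, 3‖x₀‖/2], a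
compact interval away from zero on which y ↦ (y²)^γ is C¹ and positive. -/
theorem exists_lipschitz_cutoff (γ : ℝ) {x₀ : H} (hx : x₀ ≠ 0) :
    ∃ (A : H → ℝ) (α β : ℝ) (Λ : NNReal), 0 < α ∧ LipschitzWith Λ A ∧
      (∀ v, α ≤ A v) ∧ (∀ v, A v ≤ β) ∧
      ∀ v, ‖v - x₀‖ ≤ ‖x₀‖ / 2 → A v = (‖v‖ ^ 2) ^ γ := by
  have hr : 0 < ‖x₀‖ := norm_pos_iff.mpr hx
  have hle : ‖x₀‖ / 2 ≤ 3 * ‖x₀‖ / 2 := by linarith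
  let I := Icc (‖x₀‖ / 2) (3 * ‖x₀‖ / 2)
  let g : ℝ → ℝ := fun y => (y ^ 2) ^ γ
  have hpos : ∀ y ∈ I, 0 < y := fun y hy => (half_pos hr).trans_le hy.1
  have hg : ContDiffOn ℝ 1 g I := by
    intro y hy
    exact ((contDiffAt_id.pow 2).rpow_const_of_ne (pow_pos (hpos y hy) 2).ne').contDiffWithinAt
  obtain ⟨Λ, hΛ⟩ := hg.exists_lipschitzOnWith one_ne_zero (convex_Icc _ _) isCompact_Icc
  have hne : I.Nonempty := nonempty_Icc.mpr hle
  obtain ⟨y₁, hy₁, hmin⟩ := isCompact_Icc.exists_isMinOn hne hg.continuousOn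
  obtain ⟨y₂, hy₂, hmax⟩ := isCompact_Icc.exists_isMaxOn hne hg.continuousOn
  refine ⟨fun v => g (projIcc _ _ hle ‖v‖), g y₁, g y₂, Λ, ?_, ?_, ?_, ?_, ?_⟩
  · exact Real.rpow_pos_of_pos (pow_pos (hpos y₁ hy₁) 2) γ
  · have h1 : LipschitzWith (1 * (1 * 1)) fun v : H => (projIcc _ _ hle ‖v‖ : ℝ) :=
      LipschitzWith.subtype_val _ |>.comp ((LipschitzWith.projIcc hle).comp lipschitzWith_one_norm)
    intro v w
    refine (hΛ (projIcc _ _ hle ‖v‖).2 (projIcc _ _ hle ‖w‖).2).trans ?_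
    gcongr
    simpa using h1 v w
  · exact fun v => hmin (projIcc _ _ hle ‖v‖).2
  · exact fun v => hmax (projIcc _ _ hle ‖v‖).2
  · intro v hv
    have h1 := abs_norm_sub_norm_le v x₀
    have h2 := abs_le.mp (h1.trans hv)
    have h3 : ‖v‖ ∈ Icc (‖x₀‖ / 2) (3 * ‖x₀‖ / 2) := ⟨by linarith, by linarith⟩
    simp only [projIcc_of_mem hle h3, g]

theorem IsEvolution.congr_coeff {a₁ a₂ : ℝ → ℝ} {u : L2Time τ V} {p : L2Time τ H}
    (h : IsEvolution ι G a₁ x₀ F u p) (ha : ∀ t ∈ Icc 0 τ, a₁ t = a₂ t) :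
    IsEvolution ι G a₂ x₀ F u p := by
  refine ⟨h.primitive, ?_⟩
  filter_upwards [h.weak, ae_mem_Icc] with t h1 ht w
  rw [← ha t ht]
  exact h1 w

/-- Banach's fixed point theorem in C([0,τ]; H) for the map sending U to the solution of the linear
problem with coefficient A(U(t)). By `IsEvolution.energy_sub_le` with δ = Λ · dist, the bound 1/4 on
squares gives the contraction factor 1/2. -/
theorem exists_isEvolution_nonlinear (hτ : 0 < τ) (hV : ∀ v, ‖v‖ ^ 2 = ‖ι v‖ ^ 2 + ‖G v‖ ^ 2)
    {A : H → ℝ} {α β : ℝ} {Λ : NNReal} (hα : 0 < α) (hA : LipschitzWith Λ A)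
    (hAα : ∀ v, α ≤ A v) (hAβ : ∀ v, A v ≤ β) (u₀ : V) (F : L2Time τ H) {D : ℝ}
    (hD : (2 / α * ‖F‖ + 2 * ‖G u₀‖) / min (1 / β) (1 / 2) ≤ D)
    (hsmall : (Λ : ℝ) ^ 2 / α * (√τ * (D + ‖G u₀‖)) ^ 2 ≤ 1 / 4) :
    ∃ (u : L2Time τ V) (p : L2Time τ H),
      IsEvolution ι G (fun t => A (ι u₀ + ∫ s in (0 : ℝ)..t, p s)) (ι u₀) F u p ∧ ‖p‖ ≤ D ∧
      ‖G.compLpL 2 (volume.restrict (Ioo 0 τ)) u‖ ≤ √τ * (D + ‖G u₀‖) := by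
  let coeff : C(Icc 0 τ, H) → ℝ → ℝ := fun U t => A (U (projIcc 0 τ hτ.le t))
  have hcont : ∀ U, Continuous (coeff U) := fun U =>
    hA.continuous.comp (U.continuous.comp continuous_projIcc)
  choose u p hup hp hu using fun U : C(Icc 0 τ, H) =>
    exists_isEvolution hτ hV (hcont U).continuousOn hα (fun _ _ => hAα _) (fun _ _ => hAβ _)
      u₀ F hD
  let Φ : C(Icc 0 τ, H) → C(Icc 0 τ, H) := fun U =>
    ⟨fun t => ι u₀ + ∫ s in (0 : ℝ)..t, p U s,
      continuousOn_iff_continuous_domRestrict.mp ((p U).continuousOn_primitive (ι u₀))⟩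
  have hΦ : ContractingWith (1 / 2) Φ := by
    refine ⟨by norm_num, LipschitzWith.of_dist_le_mul fun U₁ U₂ => ?_⟩
    rw [ContinuousMap.dist_le (by positivity)]
    intro t
    have h := (hup U₁).energy_sub_le (hup U₂) t.2 hα (fun _ _ => hAα _)
      (δ := Λ * dist U₁ U₂) (fun s _ => by
        rw [← Real.dist_eq]
        exact (hA.dist_le_mul _ _).trans
          (mul_le_mul_of_nonneg_left (ContinuousMap.dist_apply_le_dist _) Λ.2))
    have h1 : 0 ≤ ∫ s in Ioo 0 (t : ℝ), ‖G (u U₁ s) - G (u U₂ s)‖ ^ 2 :=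
      integral_nonneg fun _ => sq_nonneg _
    have h2 : ‖G.compLpL 2 (volume.restrict (Ioo 0 τ)) (u U₂)‖ ^ 2
        ≤ (√τ * (D + ‖G u₀‖)) ^ 2 := pow_le_pow_left₀ (norm_nonneg _) (hu U₂) 2
    change dist (ι u₀ + ∫ s in (0 : ℝ)..t, p U₁ s) (ι u₀ + ∫ s in (0 : ℝ)..t, p U₂ s) ≤ _
    rw [dist_eq_norm, add_sub_add_left_eq_sub]
    have hcoe : ((1 / 2 : NNReal) : ℝ) = 1 / 2 := by norm_num
    rw [hcoe]
    refine abs_le_of_sq_le_sq' ?_ (by positivity) |>.2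
    calc _ ≤ (Λ * dist U₁ U₂) ^ 2 / α * ‖G.compLpL 2 (volume.restrict (Ioo 0 τ)) (u U₂)‖ ^ 2 := by
            nlinarith
      _ ≤ (Λ * dist U₁ U₂) ^ 2 / α * (√τ * (D + ‖G u₀‖)) ^ 2 :=
          mul_le_mul_of_nonneg_left h2 (by positivity)
      _ = dist U₁ U₂ ^ 2 * ((Λ : ℝ) ^ 2 / α * (√τ * (D + ‖G u₀‖)) ^ 2) := by ring
      _ ≤ dist U₁ U₂ ^ 2 * (1 / 4) := mul_le_mul_of_nonneg_left hsmall (sq_nonneg _)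
      _ = (1 / 2 * dist U₁ U₂) ^ 2 := by ring
  have hfix : Φ (ContractingWith.fixedPoint Φ hΦ) = ContractingWith.fixedPoint Φ hΦ :=
    ContractingWith.fixedPoint_isFixedPt hΦ
  set U := ContractingWith.fixedPoint Φ hΦ
  refine ⟨u U, p U, (hup U).congr_coeff fun t ht => ?_, hp U, hu U⟩
  have : Φ U ⟨t, ht⟩ = U ⟨t, ht⟩ := by rw [hfix]
  simp only [coeff, projIcc_of_mem hτ.le ht]
  rw [← this]
  rfl

/-- A continuity argument: `u₂` is the reference solution, known to stay strictly inside the ball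
where `B` equals the cutoff `A`, while `u₁` is arbitrary and is shown not to leave the ball. -/
theorem IsEvolution.unique (hV : ∀ v, ‖v‖ ^ 2 = ‖ι v‖ ^ 2 + ‖G v‖ ^ 2) (hτ : 0 < τ)
    {A B : H → ℝ} {α r E : ℝ} {Λ : NNReal} (hα : 0 < α) (hA : LipschitzWith Λ A)
    (hAα : ∀ v, α ≤ A v) (hB : ∀ v, ‖v - x₀‖ ≤ r → B v = A v)
    (hsmall : (Λ : ℝ) ^ 2 / α * E ^ 2 ≤ 1 / 4)
    {u₁ u₂ : L2Time τ V} {p₁ p₂ : L2Time τ H}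
    (h₁ : IsEvolution ι G (fun t => B (x₀ + ∫ s in (0 : ℝ)..t, p₁ s)) x₀ F u₁ p₁)
    (h₂ : IsEvolution ι G (fun t => B (x₀ + ∫ s in (0 : ℝ)..t, p₂ s)) x₀ F u₂ p₂)
    (hr : ∀ t ∈ Icc 0 τ, ‖∫ s in (0 : ℝ)..t, p₂ s‖ < r)
    (hE : ‖G.compLpL 2 (volume.restrict (Ioo 0 τ)) u₂‖ ≤ E) : u₁ = u₂ := by
  set U₁ : ℝ → H := fun t => x₀ + ∫ s in (0 : ℝ)..t, p₁ s with hU₁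
  set U₂ : ℝ → H := fun t => x₀ + ∫ s in (0 : ℝ)..t, p₂ s with hU₂
  have hc₁ : ContinuousOn U₁ (Icc 0 τ) := p₁.continuousOn_primitive x₀
  have hc₂ : ContinuousOn U₂ (Icc 0 τ) := p₂.continuousOn_primitive x₀
  have hr₂ : ∀ t ∈ Icc 0 τ, ‖U₂ t - x₀‖ < r := fun t ht => by
    simpa only [hU₂, add_sub_cancel_left] using hr t ht
  have hsubU : ∀ t, U₁ t - U₂ t = (∫ s in (0 : ℝ)..t, p₁ s) - ∫ s in (0 : ℝ)..t, p₂ s := fun t => by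
    simp only [hU₁, hU₂, add_sub_add_left_eq_sub]
  -- Being in the ball is assumed only before `t`, yet equality holds at `t` too, so this applies at
  -- the exit time itself. At a time `m` where the difference is largest, the energy estimate bounds
  -- its square by a quarter of itself.
  have key : ∀ t ∈ Icc 0 τ, (∀ s ∈ Ico 0 t, ‖U₁ s - x₀‖ < r) → ∀ s ∈ Icc 0 t, U₁ s = U₂ s := by
    intro t ht hin
    have hsub : Icc 0 t ⊆ Icc 0 τ := Icc_subset_Icc_right ht.2
    obtain ⟨m, hm, hmax⟩ := isCompact_Icc.exists_isMaxOn (nonempty_Icc.mpr ht.1)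
      ((hc₁.sub hc₂).norm.mono hsub)
    have hmax' : ∀ s ∈ Icc 0 t, ‖U₁ s - U₂ s‖ ≤ ‖U₁ m - U₂ m‖ := fun s hs => hmax hs
    have hBA : ∀ s ∈ Ioo 0 m, B (U₁ s) = A (U₁ s) ∧ B (U₂ s) = A (U₂ s) := fun s hs =>
      ⟨hB _ (hin s ⟨hs.1.le, hs.2.trans_le hm.2⟩).le,
        hB _ (hr₂ s ⟨hs.1.le, (hs.2.le.trans hm.2).trans ht.2⟩).le⟩
    have h := h₁.energy_sub_le h₂ (hsub hm) hα (fun s hs => (hBA s hs).1 ▸ hAα _)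
      (δ := Λ * ‖U₁ m - U₂ m‖) (fun s hs => by
        rw [(hBA s hs).1, (hBA s hs).2, ← Real.dist_eq]
        refine (hA.dist_le_mul _ _).trans (mul_le_mul_of_nonneg_left ?_ Λ.2)
        rw [dist_eq_norm]
        exact hmax' s ⟨hs.1.le, hs.2.le.trans hm.2⟩)
    rw [← hsubU] at h
    have h1 : 0 ≤ ∫ s in Ioo 0 m, ‖G (u₁ s) - G (u₂ s)‖ ^ 2 :=
      integral_nonneg fun _ => sq_nonneg _
    have h2 : ‖G.compLpL 2 (volume.restrict (Ioo 0 τ)) u₂‖ ^ 2 ≤ E ^ 2 :=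
      pow_le_pow_left₀ (norm_nonneg _) hE 2
    have h3 : ‖U₁ m - U₂ m‖ ^ 2 ≤ ‖U₁ m - U₂ m‖ ^ 2 * (1 / 4) := by
      calc _ ≤ (Λ * ‖U₁ m - U₂ m‖) ^ 2 / α *
            ‖G.compLpL 2 (volume.restrict (Ioo 0 τ)) u₂‖ ^ 2 := by nlinarith
        _ ≤ (Λ * ‖U₁ m - U₂ m‖) ^ 2 / α * E ^ 2 := mul_le_mul_of_nonneg_left h2 (by positivity)
        _ = ‖U₁ m - U₂ m‖ ^ 2 * ((Λ : ℝ) ^ 2 / α * E ^ 2) := by ring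
        _ ≤ _ := mul_le_mul_of_nonneg_left hsmall (sq_nonneg _)
    have h4 : ‖U₁ m - U₂ m‖ = 0 := by nlinarith [norm_nonneg (U₁ m - U₂ m)]
    intro s hs
    exact sub_eq_zero.mp (norm_le_zero_iff.mp (h4 ▸ hmax' s hs))
  -- At the first time with ‖U₁ - x₀‖ ≥ r the curves coincide, whereas U₂ is strictly inside the
  -- ball.
  have hball : ∀ t ∈ Icc 0 τ, ‖U₁ t - x₀‖ < r := by
    by_contra! hcon
    have hcl : IsClosed (Icc 0 τ ∩ (fun t => ‖U₁ t - x₀‖) ⁻¹' Ici r) :=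
      (hc₁.sub continuousOn_const).norm.preimage_isClosed_of_isClosed isClosed_Icc isClosed_Ici
    have hK : IsCompact (Icc 0 τ ∩ (fun t => ‖U₁ t - x₀‖) ⁻¹' Ici r) :=
      isCompact_Icc.of_isClosed_subset hcl inter_subset_left
    obtain ⟨t, ht, hle⟩ := hK.exists_isLeast (let ⟨t, ht, h⟩ := hcon; ⟨t, ht, h⟩)
    have heq := key t ht.1 (fun s hs => by
      by_contra! h
      exact (hle ⟨⟨hs.1, hs.2.le.trans ht.1.2⟩, h⟩).not_gt hs.2) t ⟨ht.1.1, le_rfl⟩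
    have h1 : r ≤ ‖U₁ t - x₀‖ := ht.2
    rw [heq] at h1
    exact (hr₂ t ht.1).not_ge h1
  have hτm : τ ∈ Icc 0 τ := right_mem_Icc.mpr hτ.le
  have heq := key τ hτm fun s hs => hball s ⟨hs.1, hs.2.le⟩
  -- The H-valued curves now agree, hence so do the coefficients; with δ = 0 the estimate forces the
  -- G-parts to agree, which gives equality in L₂(0,τ; V).
  have h := h₁.energy_sub_le h₂ hτm hα
    (fun s hs => by
      have := hAα (U₁ s)
      rwa [← hB _ (hball s (Ioo_subset_Icc_self hs)).le] at this)
    (δ := 0) (fun s hs => by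
      change |B (U₁ s) - B (U₂ s)| ≤ 0
      rw [heq s (Ioo_subset_Icc_self hs), sub_self, abs_zero])
  rw [zero_pow two_ne_zero, zero_div, zero_mul] at h
  have hint : ∫ s in Ioo 0 τ, ‖G (u₁ s) - G (u₂ s)‖ ^ 2 ≤ 0 := by
    by_contra! hcon
    nlinarith [mul_pos hα hcon, sq_nonneg ‖(∫ s in (0 : ℝ)..τ, p₁ s) - ∫ s in (0 : ℝ)..τ, p₂ s‖]
  have hu : ‖u₁ - u₂‖ ^ 2 ≤ 0 := by
    rw [norm_sq_eq_integral]
    refine le_trans (le_of_eq (integral_congr_ae ?_)) hint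
    filter_upwards [Lp.coeFn_sub u₁ u₂, h₁.primitive, h₂.primitive, ae_mem_Icc] with s e1 e2 e3 hs
    have e4 : ι (u₁ s - u₂ s) = 0 := by
      rw [map_sub, e2, e3]
      exact sub_eq_zero.mpr (heq s hs)
    rw [e1, Pi.sub_apply, hV, e4, map_sub, norm_zero, zero_pow two_ne_zero, zero_add]
  have : ‖u₁ - u₂‖ = 0 := by nlinarith [norm_nonneg (u₁ - u₂)]
  exact sub_eq_zero.mp (norm_eq_zero.mp this)

end NonlinearProblem

/-! ### Translation between H₀¹(Ω) and the abstract setting -/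

section Concrete

variable {d : ℕ} {Ω : Set (Euc d)}

instance H01.instCompleteSpace : CompleteSpace (H01 Ω) :=
  (Submodule.isClosed_topologicalClosure (testPairs Ω)).completeSpace_coe

/-- The embedding `H₀¹(Ω) → L₂(Ω)` as a continuous linear map. -/
noncomputable def toL2L (Ω : Set (Euc d)) : H01 Ω →L[ℝ] L2 Ω :=
  (WithLp.fstL 2 ℝ (L2 Ω) (L2Vec Ω)) ∘L (H01 Ω).subtypeL

/-- The gradient `H₀¹(Ω) → L₂(Ω; ℝᵈ)` as a continuous linear map. -/
noncomputable def gradL (Ω : Set (Euc d)) : H01 Ω →L[ℝ] L2Vec Ω :=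
  (WithLp.sndL 2 ℝ (L2 Ω) (L2Vec Ω)) ∘L (H01 Ω).subtypeL

theorem toL2L_apply (v : H01 Ω) : toL2L Ω v = toL2 v := rfl

theorem H01.norm_sq (v : H01 Ω) : ‖v‖ ^ 2 = ‖toL2L Ω v‖ ^ 2 + ‖gradL Ω v‖ ^ 2 :=
  WithLp.prod_norm_sq_eq_of_L2 (v : WithLp 2 (L2 Ω × L2Vec Ω))

theorem L2.inner_eq_integral_mul (v w : L2 Ω) : ∫ x in Ω, v x * w x = inner ℝ v w := by
  rw [L2.inner_def]
  simp only [RCLike.inner_apply, conj_trivial, mul_comm]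

theorem diffusionCoeff_eq (γ : ℝ) (v : L2 Ω) : diffusionCoeff γ v = (‖v‖ ^ 2) ^ γ := by
  rw [diffusionCoeff, ← real_inner_self_eq_norm_sq, ← L2.inner_eq_integral_mul]
  simp only [sq]

theorem hasWeakTimeDeriv_iff {τ : ℝ} (hτ : 0 ≤ τ) (u u' : ℝ → L2 Ω) :
    HasWeakTimeDeriv τ u u' ↔ ∀ φ : ℝ → ℝ, IsTestFunction (Ioo 0 τ) φ →
      ∫ t in (0 : ℝ)..τ, deriv φ t • u t = -∫ t in (0 : ℝ)..τ, φ t • u' t := by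
  simp only [HasWeakTimeDeriv, intervalIntegral.integral_of_le hτ, integral_Ioc_eq_integral_Ioo]

/-- A continuous representative whose weak derivative is p must be u₀ + ∫ p, and conversely this
primitive is such a representative. The coefficient can therefore be evaluated along the primitive
at every time. -/
theorem isWeakSolution_iff {γ τ : ℝ} (hτ : 0 < τ) (u₀ : H01 Ω) (f : ℝ → H01 Ω)
    (u : L2Time τ (H01 Ω)) :
    IsWeakSolution Ω γ τ u₀ f u ↔ ∃ p : L2Time τ (L2 Ω), IsEvolution (toL2L Ω) (gradL Ω)
      (fun t => diffusionCoeff γ (toL2 u₀ + ∫ s in (0 : ℝ)..t, p s)) (toL2 u₀)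
      (fun t => toL2 (f t)) u p := by
  have hτm : τ ∈ Icc 0 τ := right_mem_Icc.mpr hτ.le
  constructor
  · rintro ⟨⟨p, hd, hw⟩, U, hU, hUu, hU0⟩
    rw [hasWeakTimeDeriv_iff hτ.le] at hd
    have hprim := eqOn_primitive_of_weak_deriv hτ hU (p.intervalIntegrable hτm) (by
      intro φ hφ
      rw [← hd φ hφ]
      refine L2Time.intervalIntegral_congr ?_ hτm
      filter_upwards [hUu] with t ht
      rw [ht])
    have hprim' : ∀ᵐ t ∂(volume.restrict (Ioo 0 τ)),
        toL2 (u t) = toL2 u₀ + ∫ s in (0 : ℝ)..t, p s := by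
      filter_upwards [hUu, L2Time.ae_mem_Icc] with t h1 ht
      rw [← h1, hprim t ht, hU0]
    refine ⟨p, hprim', ?_⟩
    filter_upwards [hprim', hw] with t h1 h2 w
    have := h2 w
    rw [L2.inner_eq_integral_mul, L2.inner_eq_integral_mul, ← L2.inner_def, h1] at this
    exact this
  · rintro ⟨p, hprim, hw⟩
    refine ⟨⟨p, ?_, ?_⟩, fun t => toL2 u₀ + ∫ s in (0 : ℝ)..t, p s,
      p.continuousOn_primitive _, ?_, by simp⟩
    · rw [hasWeakTimeDeriv_iff hτ.le]
      intro φ hφ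
      rw [← weak_deriv_primitive (toL2 u₀) (p.intervalIntegrable hτm) hφ]
      refine L2Time.intervalIntegral_congr ?_ hτm
      filter_upwards [hprim] with t ht
      rw [← ht]
      rfl
    · filter_upwards [hprim, hw] with t h1 h2 w
      have := h2 w
      rw [← h1] at this
      rw [L2.inner_eq_integral_mul, L2.inner_eq_integral_mul, ← L2.inner_def]
      exact this
    · filter_upwards [hprim] with t ht
      exact ht.symm

theorem IsEvolution.congr_force {H V W : Type} [NormedAddCommGroup H] [InnerProductSpace ℝ H]
    [NormedAddCommGroup V] [InnerProductSpace ℝ V] [NormedAddCommGroup W] [InnerProductSpace ℝ W]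
    {τ : ℝ} {ι : V →L[ℝ] H} {G : V →L[ℝ] W} {x₀ : H} {F₁ F₂ : ℝ → H} {a : ℝ → ℝ}
    {u : L2Time τ V} {p : L2Time τ H} (h : IsEvolution ι G a x₀ F₁ u p)
    (hF : ∀ᵐ t ∂(volume.restrict (Ioo 0 τ)), F₁ t = F₂ t) : IsEvolution ι G a x₀ F₂ u p := by
  refine ⟨h.primitive, ?_⟩
  filter_upwards [h.weak, hF] with t h1 h2 w
  rw [← h2]
  exact h1 w

end Concrete

/-! ### Choice of t* and conclusion -/

theorem mainTheorem3 {d : ℕ} (hd : 1 ≤ d) (Ω : Set (Euc d)) (hΩ : IsOpen Ω)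
    (hΩb : Bornology.IsBounded Ω) (γ T : ℝ) (hT : 0 < T) (u₀ : H01 Ω) (f : ℝ → H01 Ω)
    (hf : MemLp f 2 (volume.restrict (Ioo 0 T)))
    (hu₀ : 0 < ∫ x in Ω, toL2 u₀ x) :
    ∃ tstar : ℝ, 0 < tstar ∧ tstar ≤ T ∧
      ∀ τ : ℝ, 0 < τ → τ ≤ tstar →
        ∃! u : L2Time τ (H01 Ω), IsWeakSolution Ω γ τ u₀ f u := by
  have hx₀ : toL2 u₀ ≠ 0 := by
    intro h
    rw [h, integral_congr_ae (Lp.coeFn_zero ℝ 2 (volume.restrict Ω))] at hu₀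
    simp at hu₀
  obtain ⟨A, α, β, Λ, hα, hA, hAα, hAβ, hAx⟩ := exists_lipschitz_cutoff γ hx₀
  have hβ : 0 < β := hα.trans_le ((hAα 0).trans (hAβ 0))
  have hFT : MemLp (fun t => toL2 (f t)) 2 (volume.restrict (Ioo 0 T)) :=
    (toL2L Ω).comp_memLp' hf
  set r := ‖toL2 u₀‖ / 2 with hr
  have hrpos : 0 < r := half_pos (norm_pos_iff.mpr hx₀)
  -- The force is measured on all of (0,T), so that `D` does not depend on τ.
  set D := (2 / α * ‖hFT.toLp‖ + 2 * ‖gradL Ω u₀‖) / min (1 / β) (1 / 2) with hD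
  have hmin : 0 < min (1 / β) (1 / 2) := lt_min (by positivity) (by norm_num)
  have hD0 : 0 ≤ D := by positivity
  set E := D + ‖gradL Ω u₀‖ with hE
  have hE0 : 0 ≤ E := by positivity
  -- √τ ≤ `s₁` keeps the solution in the ball of radius `r`, and τ ≤ `s₂` gives the smallness needed
  -- for contraction and uniqueness. Adding 1 keeps the denominators positive when `D`, `E` or `Λ`
  -- vanishes.
  set s₁ := r / (2 * (D + 1)) with hs₁
  set s₂ := α / (4 * ((Λ : ℝ) ^ 2 * E ^ 2 + 1)) with hs₂
  have hs₁0 : 0 < s₁ := by positivity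
  have hs₂0 : 0 < s₂ := by positivity
  refine ⟨min T (min (s₁ ^ 2) s₂), lt_min hT (lt_min (by positivity) hs₂0), min_le_left _ _, ?_⟩
  intro τ hτ hle
  have hτT : τ ≤ T := hle.trans (min_le_left _ _)
  have hτ1 : √τ ≤ s₁ := Real.sqrt_le_iff.mpr
    ⟨hs₁0.le, hle.trans ((min_le_right _ _).trans (min_le_left _ _))⟩
  have hτ2 : τ ≤ s₂ := hle.trans ((min_le_right _ _).trans (min_le_right _ _))
  have hsD : √τ * D < r := by
    calc √τ * D ≤ s₁ * D := mul_le_mul_of_nonneg_right hτ1 hD0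
      _ < s₁ * (2 * (D + 1)) := by gcongr; linarith
      _ = r := by rw [hs₁]; field_simp
  have hsmall : (Λ : ℝ) ^ 2 / α * (√τ * E) ^ 2 ≤ 1 / 4 := by
    rw [mul_pow, Real.sq_sqrt hτ.le]
    calc (Λ : ℝ) ^ 2 / α * (τ * E ^ 2) = (Λ : ℝ) ^ 2 * E ^ 2 / α * τ := by ring
      _ ≤ ((Λ : ℝ) ^ 2 * E ^ 2 + 1) / α * s₂ := by gcongr; linarith
      _ = 1 / 4 := by rw [hs₂]; field_simp
  have hμ : (volume : Measure ℝ).restrict (Ioo 0 τ) ≤ volume.restrict (Ioo 0 T) :=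
    Measure.restrict_mono (Ioo_subset_Ioo_right hτT) le_rfl
  have hFτ := hFT.mono_measure hμ
  let F : L2Time τ (L2 Ω) := hFτ.toLp
  have hFn : ‖F‖ ≤ ‖hFT.toLp‖ := by
    rw [Lp.norm_toLp, Lp.norm_toLp]
    exact ENNReal.toReal_mono hFT.eLpNorm_ne_top (eLpNorm_mono_measure _ hμ)
  have hFae : ∀ᵐ t ∂(volume.restrict (Ioo 0 τ)), F t = toL2 (f t) := hFτ.coeFn_toLp
  obtain ⟨u, p, hup, hpn, hun⟩ := exists_isEvolution_nonlinear hτ H01.norm_sq hα hA hAα hAβ u₀ F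
    (D := D) (by rw [hD]; gcongr) hsmall
  have hpr : ∀ t ∈ Icc 0 τ, ‖∫ s in (0 : ℝ)..t, p s‖ < r := fun t ht =>
    (p.norm_integral_le ht).trans_lt
      ((mul_le_mul_of_nonneg_left hpn (Real.sqrt_nonneg τ)).trans_lt hsD)
  have hBA : ∀ v : L2 Ω, ‖v - toL2 u₀‖ ≤ r → diffusionCoeff γ v = A v := fun v hv => by
    rw [hAx v hv, diffusionCoeff_eq]
  have hsol := (hup.congr_force hFae).congr_coeff
    (a₂ := fun t => diffusionCoeff γ (toL2 u₀ + ∫ s in (0 : ℝ)..t, p s)) (fun t ht => by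
      refine (hBA _ ?_).symm
      rw [toL2L_apply, add_sub_cancel_left]
      exact (hpr t ht).le)
  refine ⟨u, (isWeakSolution_iff hτ u₀ f u).mpr ⟨p, hsol⟩, fun v hv => ?_⟩
  obtain ⟨q, hq⟩ := (isWeakSolution_iff hτ u₀ f v).mp hv
  exact hq.unique H01.norm_sq hτ hα hA hAα hBA hsmall hsol hpr hun
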